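/- **Theorem 2 (Rate of ID).** Let $A,E,\beta,\gamma>0$, let $Q$ be the standard Gaussian tail function, $\bar\epsilon=2Q(\beta)$, and $N=\max\{0,\lceil\log_2(\gamma(A+2\beta))\rceil\}$. *Noise.* Let $K$ take the values $k\in\{-\lceil\gamma A\rceil,\dots,\lceil\gamma(A+2\beta)\rceil-1\}$ with probabilities $\frac1T\big[Q(\tfrac{k-\gamma\beta}{\gamma})-Q(\tfrac{k+1-\gamma\beta}{\gamma})\big]$, where $T=Q\big(\tfrac{-\lceil\gamma A\rceil-\gamma\beta}{\gamma}\big)-Q\big(\tfrac{\lceil\gamma(A+2\beta)\rceil-\gamma\beta}{\gamma}\big)$. Let $(Z_0^b,\dots,Z_{N-1}^b)$ be the $N$-bit binary representation of $K$ (of $2^N+K$ if $K<0$), and let $\alpha_i=\mathcal P\{Z_i^b=1\}$. *Channel.* The vector binary channel with erasures has input $\boldsymbol X^b=(X_0^b,\dots,X_{N-1}^b)\in\{0,1\}^N$. It is memoryless over time. In each use, the output is erased on all bit-pipes with probability $\epsilon(\boldsymbol X^b)$; otherwise bit-pipe $i$ outputs $Y_i^b=(X_i^b+Z_i^b+W_i^b)\bmod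 2$, where $W_0^b=0$, $W_{i+1}^b=(X_i^bZ_i^b+X_i^bW_i^b+Z_i^bW_i^b)\bmod 2$, and the noise is independent of the input and of the erasure. Here $\epsilon:\{0,1\}^N\to[0,1]$ is any function with $\epsilon(\boldsymbol x)\le\bar\epsilon$ whenever $\sum_i x_i2^i\le\gamma A$ (in particular, $\epsilon\equiv\bar\epsilon$ is allowed). *Scheme.* In the independent decoding (ID) scheme the message is split into $m_0,\dots,m_{N-1}$, and $m_i$ is encoded into the length-$n$ input sequence of bit-pipe $i$ by a code of its own. For $i=0,\dots,N-1$ in this order, $m_i$ is decoded from the output sequence of bit-pipe $i$ alone, after subtracting modulo $2$ the carry-over bits that are computed from the previous decisions and the unerased outputs of the lower bit-pipes. The rate is $\sum_i\frac1n\log_2M_i$, where $M_i$ is the number of messages $m_i$. *Rate.* Let $\mathsf h$ be the binary entropy function in bits and $p\circledast\alpha=p(1-\alpha)+(1-p)\alpha$. Let $\mathcal A$ be the set of $\boldsymbol p\in[0,1]^N$ with $\sum_{i:\,p_i>0}2^i\le\gamma A$ and $\sum_{i:\,p_i>0}p_i2^i\le\gamma E$. Then: 1. The maximum $S=\max_{\boldsymbol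 p\in\mathcal A}\sum_{i=0}^{N-1}\big(\mathsf h(p_i\circledast\alpha_i)-\mathsf h(\alpha_i)\big)$ is attained. 2. For every $\boldsymbol p\in\mathcal A$, the ID scheme with random codebooks whose symbols are independent, and Bernoulli$(p_i)$ on bit-pipe $i$ (with $M_i=1$ if $p_i=0$), achieves the rate $(1-\bar\epsilon)\sum_i(\mathsf h(p_i\circledast\alpha_i)-\mathsf h(\alpha_i))$: for every $\delta>0$ and all sufficiently large $n$ there are message set sizes $M_i\ge1$ of total rate at least this value minus $\delta$, and rules that make a decoder of each bit-pipe out of the codebook of that bit-pipe, such that each message tuple has error probability at most $\delta$ on average over the codebooks. 3. The rate $R_{\mathrm{ID}}=(1-\bar\epsilon)S$ is achievable by ID under the intensity constraints: for every $\delta>0$ and all sufficiently large $n$ there is a (deterministic) ID code of length $n$ and rate at least $R_{\mathrm{ID}}-\delta$ such that each transmitted sequence satisfies $\sum_iX_i^b(t)2^i\le\gamma A$ at all times $t$ and $\frac1n\sum_t\sum_iX_i^b(t)2^i\le\gamma E$, and the error probability averaged over the messages is at most $\delta$. If $\epsilon$ is constant, then the same holds with the maximal error probability over the messages. -/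

import Mathlib

noncomputable section

namespace VBC

/-! ### Parameters and the binary noise -/

/-- The standard Gaussian tail function. -/
def gaussQ (x : ℝ) : ℝ :=
  (Real.sqrt (2 * Real.pi))⁻¹ * ∫ u in Set.Ioi x, Real.exp (-u ^ 2 / 2)

/-- The upper bound `2 Q(β)` on the erasure probability. -/
def erasureBound (β : ℝ) : ℝ := 2 * gaussQ β

/-- The number of bit-pipes (it is `0` when `γ (A + 2 β) ≤ 1`, where the logarithm is `≤ 0`). -/
def numBits (A β γ : ℝ) : ℕ := ⌈Real.logb 2 (γ * (A + 2 * β))⌉₊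

/-- The integers `k` for which the unit interval `[k, k + 1)` is one of the quantization cells of
the biased and scaled noise `γ (Z + β)`, where `Z` is standard Gaussian. -/
def noiseSupport (A β γ : ℝ) : Finset ℤ :=
  Finset.Ico (-⌈γ * A⌉) ⌈γ * (A + 2 * β)⌉

/-- The normalization: the probability that `γ (Z + β)` lies in the union of the cells. -/
def noiseNorm (A β γ : ℝ) : ℝ :=
  gaussQ ((-(⌈γ * A⌉ : ℝ) - γ * β) / γ) - gaussQ (((⌈γ * (A + 2 * β)⌉ : ℝ) - γ * β) / γ)

/-- The probability that `γ (Z + β)` lies in the cell `[k, k + 1)`, given that it lies in the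
union of the cells. -/
def noiseMass (A β γ : ℝ) (k : ℤ) : ℝ :=
  (gaussQ (((k : ℝ) - γ * β) / γ) - gaussQ (((k : ℝ) + 1 - γ * β) / γ)) / noiseNorm A β γ

/-- The `i`-th bit of the `N`-bit representation of `k`, with two's complement for `k < 0`. -/
def noiseBits (N : ℕ) (k : ℤ) (i : Fin N) : Bool :=
  decide ((((if k < 0 then 2 ^ N else 0) + k) / 2 ^ (i : ℕ)) % 2 = 1)

/-- The crossover probability `α i`, the probability that the `i`-th noise bit is `1`. -/
def crossover (A β γ : ℝ) (N : ℕ) (i : Fin N) : ℝ :=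
  ∑ k ∈ (noiseSupport A β γ).filter (fun k => noiseBits N k i = true), noiseMass A β γ k

/-! ### The vector binary channel with erasures -/

/-- `(x z + x w + z w) mod 2`. -/
def carryBit (x z w : Bool) : Bool := xor (xor (x && z) (x && w)) (z && w)

/-- The carry-over bit `W i` produced by the input bits `x` and the noise bits `z`. -/
def carry {N : ℕ} (x z : Fin N → Bool) : ℕ → Bool
  | 0 => false
  | i + 1 => if h : i < N then carryBit (x ⟨i, h⟩) (z ⟨i, h⟩) (carry x z i) else false

/-- The unerased output `Y i = (X i + Z i + W i) mod 2`. -/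
def output {N : ℕ} (x z : Fin N → Bool) (i : Fin N) : Bool :=
  xor (xor (x i) (z i)) (carry x z i)

/-- The transition probabilities of one use of the channel. With probability `e x` the output is
erased (on all bit-pipes at once, output `none`); otherwise it is `output x z`, where `z` is the
vector of noise bits, independent of the input and of the erasure. -/
def trans (A β γ : ℝ) {N : ℕ} (e : (Fin N → Bool) → ℝ) (x : Fin N → Bool) :
    Option (Fin N → Bool) → ℝ
  | none => e x
  | some y => (1 - e x) *
      ∑ k ∈ (noiseSupport A β γ).filter (fun k => output x (noiseBits N k) = y), noiseMass A β γ k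

/-- The integer `∑ X i 2 ^ i` represented by the input bits (it is sent as the intensity
`X = (∑ X i 2 ^ i) / γ`). -/
def value {N : ℕ} (x : Fin N → Bool) : ℝ := ∑ i, if x i then (2 : ℝ) ^ (i : ℕ) else 0

/-! ### Independent encoding and independent (successive) decoding -/

/-- A code for the independent decoding scheme of length `n`: for each bit-pipe `i` an encoder of
the message `m i` and a decoder that sees one ternary sequence (`none` is the erasure) only. -/
structure IDCode (N n : ℕ) (M : Fin N → ℕ) where
  /-- The codewords of bit-pipe `i`. -/
  enc : (i : Fin N) → Fin (M i) → Fin n → Bool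
  /-- The decoder of bit-pipe `i`. -/
  dec : (i : Fin N) → (Fin n → Option Bool) → Fin (M i)

namespace IDCode

variable {N n : ℕ} {M : Fin N → ℕ}

/-- The channel input at time `t` for the messages `m`. -/
def input (C : IDCode N n M) (m : (i : Fin N) → Fin (M i)) (t : Fin n) (i : Fin N) : Bool :=
  C.enc i (m i) t

/-- The output sequence of bit-pipe `i` after the carry-over bits `w` have been subtracted. -/
def cleaned (y : Fin n → Option (Fin N → Bool)) (i : Fin N) (w : Fin n → Bool) :
    Fin n → Option Bool :=
  fun t => (y t).map (fun b => xor (b i) (w t))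

/-- The receiver's estimate of the carry-over bits into bit-pipe `i`: having decoded bit-pipe
`i - 1`, it re-encodes the decision, recovers the noise bits at the unerased times, and computes
the next carry-over bits from these. (At erased times the value is irrelevant.) -/
def carryEst (C : IDCode N n M) (y : Fin n → Option (Fin N → Bool)) : ℕ → Fin n → Bool
  | 0 => fun _ => false
  | i + 1 => fun t =>
      if h : i < N then
        let w := carryEst C y i
        let ybar := cleaned y ⟨i, h⟩ w
        let xhat := C.enc ⟨i, h⟩ (C.dec ⟨i, h⟩ ybar)
        match ybar t with
        | none => false
        | some b => carryBit (xhat t) (xor b (xhat t)) (w t)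
      else false

/-- The decoded messages. -/
def decode (C : IDCode N n M) (y : Fin n → Option (Fin N → Bool)) (i : Fin N) : Fin (M i) :=
  C.dec i (cleaned y i (C.carryEst y i))

open Classical in
/-- The probability over `n` memoryless uses of the channel that not all messages are decoded
correctly, when the messages `m` are sent. -/
def errorProb (A β γ : ℝ) (e : (Fin N → Bool) → ℝ) (C : IDCode N n M)
    (m : (i : Fin N) → Fin (M i)) : ℝ :=
  ∑ y : Fin n → Option (Fin N → Bool),
    if C.decode y = m then 0 else ∏ t, trans A β γ e (C.input m t) (y t)

/-- The error probability averaged over all messages. -/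
def avgErrorProb (A β γ : ℝ) (e : (Fin N → Bool) → ℝ) (C : IDCode N n M) : ℝ :=
  (∑ m : (i : Fin N) → Fin (M i), C.errorProb A β γ e m) / ∏ i, (M i : ℝ)

/-- The total rate in bits per channel use of messages of sizes `M i` sent in `n` uses. -/
def rate (n : ℕ) (M : Fin N → ℕ) : ℝ := ∑ i, Real.logb 2 (M i) / n

/-- Every transmitted sequence satisfies the peak constraint `X ≤ A` and the average constraint
(time average of `X` at most `E`). -/
def Feasible (A E γ : ℝ) (C : IDCode N n M) : Prop :=
  ∀ m : (i : Fin N) → Fin (M i),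
    (∀ t, value (C.input m t) ≤ γ * A) ∧ (∑ t, value (C.input m t)) ≤ n * (γ * E)

end IDCode

/-- The rate `R` is achievable by independent decoding: for each `δ > 0` and all large `n` there is
a code of rate at least `R - δ` that satisfies the constraints and has average error at most `δ`. -/
def AchievableAvg (A E β γ : ℝ) {N : ℕ} (e : (Fin N → Bool) → ℝ) (R : ℝ) : Prop :=
  ∀ δ > 0, ∃ n₀ : ℕ, ∀ n ≥ n₀, ∃ M : Fin N → ℕ, (∀ i, 0 < M i) ∧ R - δ ≤ IDCode.rate n M ∧
    ∃ C : IDCode N n M, C.Feasible A E γ ∧ C.avgErrorProb A β γ e ≤ δ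

/-- The same with the maximal error probability. -/
def AchievableMax (A E β γ : ℝ) {N : ℕ} (e : (Fin N → Bool) → ℝ) (R : ℝ) : Prop :=
  ∀ δ > 0, ∃ n₀ : ℕ, ∀ n ≥ n₀, ∃ M : Fin N → ℕ, (∀ i, 0 < M i) ∧ R - δ ≤ IDCode.rate n M ∧
    ∃ C : IDCode N n M, C.Feasible A E γ ∧ ∀ m, C.errorProb A β γ e m ≤ δ

/-- The probability of the codebooks `c` when all symbols are independent and those of bit-pipe
`i` are Bernoulli with parameter `p i`. -/
def codebookProb {N n : ℕ} {M : Fin N → ℕ} (p : Fin N → ℝ)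
    (c : (i : Fin N) → Fin (M i) → Fin n → Bool) : ℝ :=
  ∏ i, ∏ j, ∏ t, if c i j t then p i else 1 - p i

/-- The rate `R` is achieved by independent decoding with random codebooks that have independent
Bernoulli `p i` symbols on bit-pipe `i`; no information is sent on bit-pipes that are off. The rule
`D i` makes the decoder of bit-pipe `i` out of the codebook of that bit-pipe. The error probability
of each message is averaged over the codebooks. -/
def EnsembleAchieves (A β γ : ℝ) {N : ℕ} (e : (Fin N → Bool) → ℝ) (p : Fin N → ℝ) (R : ℝ) :
    Prop :=
  ∀ δ > 0, ∃ n₀ : ℕ, ∀ n ≥ n₀, ∃ M : Fin N → ℕ, (∀ i, 0 < M i) ∧ (∀ i, p i = 0 → M i = 1) ∧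
    R - δ ≤ IDCode.rate n M ∧
    ∃ D : (i : Fin N) → (Fin (M i) → Fin n → Bool) → (Fin n → Option Bool) → Fin (M i),
      ∀ m : (i : Fin N) → Fin (M i),
        (∑ c : (i : Fin N) → Fin (M i) → Fin n → Bool,
          codebookProb p c *
            (IDCode.mk c (fun i => D i (c i))).errorProb A β γ e m) ≤ δ

/-! ### The rate expression -/

/-- Binary entropy in bits. -/
def binEnt (p : ℝ) : ℝ := Real.binEntropy p / Real.log 2

/-- Binary convolution. -/
def bconv (p a : ℝ) : ℝ := p * (1 - a) + (1 - p) * a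

/-- The admissible parameters: bit-pipe `i` is on if `0 < p i`. -/
def Admissible (A E γ : ℝ) (N : ℕ) : Set (Fin N → ℝ) :=
  {p | (∀ i, 0 ≤ p i ∧ p i ≤ 1) ∧
    (∑ i ∈ Finset.univ.filter (fun i => 0 < p i), (2 : ℝ) ^ (i : ℕ)) ≤ γ * A ∧
    (∑ i ∈ Finset.univ.filter (fun i => 0 < p i), p i * (2 : ℝ) ^ (i : ℕ)) ≤ γ * E}

/-- `∑ i, (h (p i ⊛ α i) - h (α i))`. -/
def sumRate (A β γ : ℝ) {N : ℕ} (p : Fin N → ℝ) : ℝ :=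
  ∑ i, (binEnt (bconv (p i) (crossover A β γ N i)) - binEnt (crossover A β γ N i))

end VBC

end

namespace VBC

/-! ### Finite product distributions -/

section FiniteProduct

variable {ι : Type*} [Fintype ι] [DecidableEq ι]

/-! Compare the receiver with one that is given the true carry-over bits. If every bit-pipe decoder
is correct with the true carries, then inductively each re-encoding is correct, the noise bits are
recovered at the unerased times, and every estimated carry needed there is the true one
(`carryEst_eq`). The two receivers then agree, and the union bound gives `errorProb_le`: the error
is at most the sum of the single-pipe errors `pipeError`. Dependence between the noise bits is
harmless, since only the marginals `crossover` enter.

On one bit-pipe a threshold decoder compares the information density of the binary symmetric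
channel, set to zero at erasures, with `n * r`. Given the input bit, the density has a nonnegative
mean without erasure, so erasures of probability at most `E` leave a mean of at least `1 - E` times
the mutual information, even if they depend on the whole input (`infoDensity_mean_ge`). For smaller
`r`, a Chernoff bound makes missing the true codeword exponentially unlikely. A wrong codeword is
independent of the output and has expected likelihood ratio one, so it passes with probability at
most `exp (-(n * r))` (`exists_decoder`).

For the intensity constraints the codebooks are drawn with slightly smaller parameters `q`, and
codewords heavier than `n * p i` are replaced by zero. This is rarely needed
(`eventually_weight_le`) and makes the code feasible. Averaging selects a codebook. If the erasure
probability is constant, `pipeError` depends on the pipe's own codeword only, and discarding the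
worse half of each codebook controls the maximal error. Continuity of `sumRate` lets `q` approach
`p`, and compactness of `Admissible` gives the maximum. -/

theorem sum_prod_pi {κ : ι → Type*} [∀ i, Fintype (κ i)] (f : (i : ι) → κ i → ℝ) :
    ∑ x : (i : ι) → κ i, ∏ i, f i (x i) = ∏ i, ∑ u, f i u := by
  rw [Finset.prod_univ_sum, Fintype.piFinset_univ]

theorem sum_prod_pi_eq_one {κ : ι → Type*} [∀ i, Fintype (κ i)] (f : (i : ι) → κ i → ℝ)
    (hf : ∀ i, ∑ u, f i u = 1) : ∑ x : (i : ι) → κ i, ∏ i, f i (x i) = 1 := by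
  rw [sum_prod_pi]; simp [hf]

/-- Resampling one coordinate does not change an expectation. -/
theorem sum_prod_resample {κ : ι → Type*} [∀ i, Fintype (κ i)] (w : (i : ι) → κ i → ℝ)
    (hw : ∀ i, ∑ u, w i u = 1) (a : ι) (F : ((i : ι) → κ i) → ℝ) :
    ∑ c : (i : ι) → κ i, (∏ i, w i (c i)) * F c =
      ∑ c : (i : ι) → κ i, (∏ i, w i (c i)) * ∑ u, w a u * F (Function.update c a u) := by
  have h1 : ∑ c : (i : ι) → κ i, (∏ i, w i (c i)) * F c =
      ∑ q : ((i : ι) → κ i) × κ a, (∏ i, w i (q.1 i)) * w a q.2 * F q.1 := by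
    rw [Fintype.sum_prod_type]
    refine Finset.sum_congr rfl fun c _ => ?_
    simp only
    rw [← Finset.sum_mul, ← Finset.mul_sum, hw, mul_one]
  have h2 : ∑ c : (i : ι) → κ i, (∏ i, w i (c i)) * ∑ u, w a u * F (Function.update c a u) =
      ∑ q : ((i : ι) → κ i) × κ a,
        (∏ i, w i (q.1 i)) * w a q.2 * F (Function.update q.1 a q.2) := by
    rw [Fintype.sum_prod_type]
    refine Finset.sum_congr rfl fun c _ => ?_
    rw [Finset.mul_sum]
    exact Finset.sum_congr rfl fun u _ => by simp only; ring
  -- Swapping coordinate `a` of `c` with the fresh sample preserves the joint weight and exchanges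
  -- the two integrands.
  have hinv : Function.Involutive
      (fun q : ((i : ι) → κ i) × κ a => (Function.update q.1 a q.2, q.1 a)) := by
    rintro ⟨c, u⟩
    simp
  rw [h1, h2]
  refine Fintype.sum_bijective _ hinv.bijective _ _ ?_
  rintro ⟨c, u⟩
  simp only [Function.update_idem, Function.update_eq_self]
  congr 1
  rw [← Finset.mul_prod_erase _ _ (Finset.mem_univ a),
    ← Finset.mul_prod_erase _ (fun i => w i (Function.update c a u i)) (Finset.mem_univ a),
    Function.update_self]
  have : ∏ x ∈ Finset.univ.erase a, w x (Function.update c a u x) =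
      ∏ x ∈ Finset.univ.erase a, w x (c x) :=
    Finset.prod_congr rfl fun x hx => by
      rw [Function.update_of_ne (Finset.ne_of_mem_erase hx)]
  rw [this]; ring

theorem sum_prod_mul_le {κ : ι → Type*} [∀ i, Fintype (κ i)] (w : (i : ι) → κ i → ℝ)
    (hw0 : ∀ i u, 0 ≤ w i u) (hw : ∀ i, ∑ u, w i u = 1) (F : ((i : ι) → κ i) → ℝ) (K : ℝ)
    (hF : ∀ c, F c ≤ K) : ∑ c : (i : ι) → κ i, (∏ i, w i (c i)) * F c ≤ K := by
  calc _ ≤ ∑ c : (i : ι) → κ i, (∏ i, w i (c i)) * K :=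
        Finset.sum_le_sum fun c _ =>
          mul_le_mul_of_nonneg_left (hF c) (Finset.prod_nonneg fun i _ => hw0 _ _)
    _ = K := by rw [← Finset.sum_mul, sum_prod_pi_eq_one w hw, one_mul]

variable {κ : Type*} [Fintype κ] {M : ι → ℕ}

/-- A bound on the conditional expectation given all codewords but one is a bound on the
expectation. -/
theorem sum_codebook_le (V : ι → κ → ℝ) (hV0 : ∀ i u, 0 ≤ V i u) (hV : ∀ i, ∑ u, V i u = 1)
    (i : ι) (j : Fin (M i)) (F : ((i : ι) → Fin (M i) → κ) → ℝ) (K : ℝ)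
    (hF : ∀ c : (i : ι) → Fin (M i) → κ,
      ∑ b, V i b * F (Function.update c i (Function.update (c i) j b)) ≤ K) :
    ∑ c : (i : ι) → Fin (M i) → κ, (∏ i, ∏ j, V i (c i j)) * F c ≤ K := by
  have hW : ∀ i, ∑ d : Fin (M i) → κ, ∏ j, V i (d j) = 1 := fun i =>
    sum_prod_pi_eq_one (fun _ => V i) fun _ => hV i
  have hW0 : ∀ i (d : Fin (M i) → κ), 0 ≤ ∏ j, V i (d j) := fun i d =>
    Finset.prod_nonneg fun _ _ => hV0 _ _
  rw [sum_prod_resample (κ := fun i => Fin (M i) → κ) (fun i d => ∏ j, V i (d j)) hW i F]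
  refine sum_prod_mul_le (κ := fun i => Fin (M i) → κ) (fun i d => ∏ j, V i (d j)) hW0 hW _ _ ?_
  intro c
  rw [sum_prod_resample (κ := fun _ : Fin (M i) => κ) (fun _ => V i) (fun _ => hV i) j]
  refine sum_prod_mul_le (κ := fun _ : Fin (M i) => κ) (fun _ => V i) (fun _ => hV0 i)
    (fun _ => hV i) _ _ ?_
  intro d
  simpa using hF (Function.update c i d)

/-- As a factor at coordinate `j`, the indicator keeps the product form, and every other coordinate
sums to one. -/
theorem sum_prod_eval {m : ℕ} [DecidableEq κ] (V : κ → ℝ) (hV : ∑ u, V u = 1) (j : Fin m)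
    (x : κ) : ∑ d : Fin m → κ, (if d j = x then ∏ l, V (d l) else 0) = V x := by
  have : ∀ d : Fin m → κ, (if d j = x then ∏ l, V (d l) else 0) =
      ∏ l, V (d l) * (if l = j then (if d l = x then 1 else 0) else 1) := by
    intro d
    rw [Finset.prod_mul_distrib]
    simp
  simp_rw [this]
  rw [sum_prod_pi (fun (l : Fin m) (u : κ) =>
    V u * (if l = j then (if u = x then 1 else 0) else 1))]
  rw [Finset.prod_eq_single j]
  · simp
  · intro l _ hl; simp [hl, hV]
  · simp

/-- The transmitted codewords are independent. -/
theorem sum_codebook_eval (V : ι → κ → ℝ) (hV : ∀ i, ∑ u, V i u = 1)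
    (m : (i : ι) → Fin (M i)) (F : (ι → κ) → ℝ) :
    ∑ c : (i : ι) → Fin (M i) → κ, (∏ i, ∏ j, V i (c i j)) * F (fun i => c i (m i)) =
      ∑ x : ι → κ, (∏ i, V i (x i)) * F x := by
  classical
  -- Splitting by the value `x` of the transmitted codewords makes the sum factorize over the
  -- bit-pipes.
  have h1 : ∀ c : (i : ι) → Fin (M i) → κ,
      (∏ i, ∏ j, V i (c i j)) * F (fun i => c i (m i)) =
        ∑ x : ι → κ, F x * ∏ i, (if c i (m i) = x i then ∏ j, V i (c i j) else 0) := by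
    intro c
    rw [Finset.sum_eq_single (fun i => c i (m i))]
    · simp [mul_comm]
    · intro x _ hx
      obtain ⟨i, hi⟩ := Function.ne_iff.mp hx
      rw [Finset.prod_eq_zero (Finset.mem_univ i) (by rw [if_neg (Ne.symm hi)]), mul_zero]
    · simp
  simp_rw [h1]
  rw [Finset.sum_comm]
  refine Finset.sum_congr rfl fun x _ => ?_
  rw [← Finset.mul_sum, mul_comm]
  congr 1
  rw [sum_prod_pi (κ := fun i => Fin (M i) → κ)
    (fun i d => if d (m i) = x i then ∏ j, V i (d j) else 0)]
  exact Finset.prod_congr rfl fun i _ => sum_prod_eval (V i) (hV i) (m i) (x i)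

end FiniteProduct

/-! ### Exponential bounds -/

/-- A finitely supported random variable of negative mean has an exponential moment below one. -/
theorem exists_exp_moment_lt_one {S : Type*} [Fintype S] (w g : S → ℝ)
    (hw : ∑ s, w s = 1) (hg : ∑ s, w s * g s < 0) :
    ∃ l > 0, ∑ s, w s * Real.exp (l * g s) < 1 := by
  -- At `l = 0` the moment is one and its slope is the mean, so it drops below one just to the
  -- right.
  have hd : HasDerivAt (fun l => ∑ s, w s * Real.exp (l * g s)) (∑ s, w s * g s) 0 := by
    refine HasDerivAt.fun_sum fun s _ => ?_
    have := (((hasDerivAt_id (0 : ℝ)).mul_const (g s)).exp).const_mul (w s)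
    simpa using this
  have h := hd.tendsto_slope_zero_right
  have hlt := h.eventually (gt_mem_nhds hg)
  obtain ⟨l, hl, hl0⟩ := (hlt.and self_mem_nhdsWithin).exists
  refine ⟨l, hl0, ?_⟩
  have hl0 : 0 < l := hl0
  simp only [zero_add, zero_mul, Real.exp_zero, mul_one, hw, smul_eq_mul] at hl
  have : l * (l⁻¹ * (∑ s, w s * Real.exp (l * g s) - 1)) < 0 := mul_neg_of_pos_of_neg hl0 hl
  rw [mul_inv_cancel_left₀ hl0.ne'] at this
  linarith

end VBC

namespace VBC

/-! ### The law of the noise bits -/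

theorem gaussQ_strictAnti : StrictAnti gaussQ := by
  intro a b hab
  have hint : MeasureTheory.Integrable (fun u : ℝ => Real.exp (-u ^ 2 / 2)) := by
    have := integrable_exp_neg_mul_sq (b := 1 / 2) (by norm_num)
    refine this.congr (Filter.Eventually.of_forall fun u => ?_)
    simp only
    congr 1; ring
  have h := intervalIntegral.integral_Ioi_sub_Ioi (f := fun u : ℝ => Real.exp (-u ^ 2 / 2))
    (μ := MeasureTheory.volume) (a := a) (b := b) hint.integrableOn hab.le
  have hpos : 0 < ∫ u in a..b, Real.exp (-u ^ 2 / 2) :=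
    intervalIntegral.intervalIntegral_pos_of_pos hint.intervalIntegrable
      (fun u => Real.exp_pos _) hab
  unfold gaussQ
  refine mul_lt_mul_of_pos_left ?_ (by positivity)
  linarith

section

variable {A β γ : ℝ} (hA : 0 < A) (hβ : 0 < β) (hγ : 0 < γ)

include hA hβ hγ

theorem noiseNorm_pos : 0 < noiseNorm A β γ := by
  unfold noiseNorm
  refine sub_pos.mpr (gaussQ_strictAnti ?_)
  refine div_lt_div_of_pos_right ?_ hγ
  have h1 : γ * A ≤ (⌈γ * A⌉ : ℝ) := Int.le_ceil _
  have h2 : γ * (A + 2 * β) ≤ (⌈γ * (A + 2 * β)⌉ : ℝ) := Int.le_ceil _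
  have h3 : 0 < γ * A := by positivity
  have h4 : 0 < γ * (A + 2 * β) := by positivity
  linarith

theorem noiseMass_pos (k : ℤ) : 0 < noiseMass A β γ k := by
  unfold noiseMass
  refine div_pos (sub_pos.mpr (gaussQ_strictAnti ?_)) (noiseNorm_pos hA hβ hγ)
  exact div_lt_div_of_pos_right (by linarith) hγ

/-- The cells are adjacent, so the tail differences telescope to the normalization. -/
theorem sum_noiseMass : ∑ k ∈ noiseSupport A β γ, noiseMass A β γ k = 1 := by
  have h1 : 0 ≤ ⌈γ * A⌉ := Int.ceil_nonneg (by positivity)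
  have h2 : 0 ≤ ⌈γ * (A + 2 * β)⌉ := Int.ceil_nonneg (by positivity)
  have tel : ∀ (F : ℤ → ℝ) (a b : ℤ), a ≤ b →
      ∑ k ∈ Finset.Ico a b, (F k - F (k + 1)) = F a - F b := by
    intro F a b hab
    induction b, hab using Int.leInduction with
    | base => simp
    | succ b hab ih =>
      rw [← Finset.insert_Ico_right_eq_Ico_add_one hab, Finset.sum_insert (by simp), ih]; ring
  have := tel (fun k => gaussQ (((k : ℝ) - γ * β) / γ)) (-⌈γ * A⌉) ⌈γ * (A + 2 * β)⌉ (by omega)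
  unfold noiseMass noiseSupport
  rw [← Finset.sum_div]
  push_cast at this
  rw [this]
  exact div_self (noiseNorm_pos hA hβ hγ).ne'

end

/-- The distribution of the vector of noise bits. -/
noncomputable def noiseLaw (A β γ : ℝ) (N : ℕ) (z : Fin N → Bool) : ℝ :=
  ∑ k ∈ (noiseSupport A β γ).filter (fun k => noiseBits N k = z), noiseMass A β γ k

theorem sum_noiseLaw_filter (A β γ : ℝ) {N : ℕ} (P : (Fin N → Bool) → Prop) [DecidablePred P] :
    ∑ z, (if P z then noiseLaw A β γ N z else 0) =
      ∑ k ∈ (noiseSupport A β γ).filter (fun k => P (noiseBits N k)), noiseMass A β γ k := by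
  simp only [noiseLaw, Finset.sum_filter]
  have : ∀ z : Fin N → Bool, (if P z then ∑ k ∈ noiseSupport A β γ,
      (if noiseBits N k = z then noiseMass A β γ k else 0) else 0) =
      ∑ k ∈ noiseSupport A β γ,
        (if noiseBits N k = z then (if P (noiseBits N k) then noiseMass A β γ k else 0)
          else 0) := by
    intro z
    split_ifs with h
    · exact Finset.sum_congr rfl fun k _ => by split_ifs <;> simp_all
    · exact (Finset.sum_eq_zero fun k _ => by split_ifs <;> simp_all).symm
  simp_rw [this]
  rw [Finset.sum_comm]
  simp

theorem sum_noiseLaw_eq_crossover (A β γ : ℝ) {N : ℕ} (i : Fin N) :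
    ∑ z, (if z i = true then noiseLaw A β γ N z else 0) = crossover A β γ N i :=
  sum_noiseLaw_filter A β γ (fun z => z i = true)

/-- Both `0` (all bits zero) and `-1` (all bits one) lie in the noise support, which puts every
crossover probability strictly between zero and one. -/
theorem noiseBits_zero {N : ℕ} (i : Fin N) : noiseBits N 0 i = false := by
  simp [noiseBits]

theorem noiseBits_neg_one {N : ℕ} (i : Fin N) : noiseBits N (-1) i = true := by
  have h : ((2 : ℤ) ^ N + -1) / 2 ^ (i : ℕ) = 2 * 2 ^ (N - 1 - i) - 1 := by
    have hN : (2 : ℤ) ^ N = 2 ^ (i : ℕ) * (2 * 2 ^ (N - 1 - i)) := by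
      rw [← pow_succ', ← pow_add]; congr 1; omega
    have hp : (0 : ℤ) < 2 ^ (i : ℕ) := by positivity
    rw [hN]
    -- Division of `2 ^ N - 1` by `2 ^ i`: the remainder is `2 ^ i - 1` and the quotient is odd.
    have hQ : (2 : ℤ) ^ (i : ℕ) * (2 * 2 ^ (N - 1 - i)) + -1 =
        (2 ^ (i : ℕ) - 1) + 2 ^ (i : ℕ) * (2 * 2 ^ (N - 1 - i) - 1) := by ring
    rw [hQ, Int.add_mul_ediv_left _ _ hp.ne', Int.ediv_eq_zero_of_lt (by omega) (by omega),
      zero_add]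
  simp only [noiseBits]
  rw [if_pos (by norm_num), h]
  simp

section

variable {A β γ : ℝ} (hA : 0 < A) (hβ : 0 < β) (hγ : 0 < γ)

include hA hβ hγ

theorem noiseLaw_nonneg {N : ℕ} (z : Fin N → Bool) : 0 ≤ noiseLaw A β γ N z :=
  Finset.sum_nonneg fun k _ => (noiseMass_pos hA hβ hγ k).le

theorem sum_noiseLaw (N : ℕ) : ∑ z, noiseLaw A β γ N z = 1 := by
  have := sum_noiseLaw_filter A β γ (N := N) (fun _ => True)
  simpa [sum_noiseMass hA hβ hγ] using this

theorem crossover_pos {N : ℕ} (i : Fin N) : 0 < crossover A β γ N i := by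
  have h1 : 0 < ⌈γ * A⌉ := Int.ceil_pos.mpr (by positivity)
  have h2 : 0 < ⌈γ * (A + 2 * β)⌉ := Int.ceil_pos.mpr (by positivity)
  refine Finset.sum_pos (fun k _ => noiseMass_pos hA hβ hγ k) ⟨-1, ?_⟩
  rw [Finset.mem_filter, noiseSupport, Finset.mem_Ico]
  exact ⟨by omega, noiseBits_neg_one i⟩

theorem crossover_lt_one {N : ℕ} (i : Fin N) : crossover A β γ N i < 1 := by
  have h1 : 0 < ⌈γ * A⌉ := Int.ceil_pos.mpr (by positivity)
  have h2 : 0 < ⌈γ * (A + 2 * β)⌉ := Int.ceil_pos.mpr (by positivity)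
  rw [← sum_noiseMass hA hβ hγ]
  refine Finset.sum_lt_sum_of_subset (Finset.filter_subset _ _) (i := 0) ?_ ?_
    (noiseMass_pos hA hβ hγ 0) (fun k _ _ => (noiseMass_pos hA hβ hγ k).le)
  · rw [noiseSupport, Finset.mem_Ico]; omega
  · simp [noiseBits_zero]

end

end VBC

namespace VBC

/-! ### Reduction to a decoder that knows the carry-over bits -/

variable {N n : ℕ}

/-- The probability that, for the input `x`, the channel erases (`none`) or the noise bits are
`z` and there is no erasure (`some z`). -/
noncomputable def stateProb (μ e : (Fin N → Bool) → ℝ) (x : Fin N → Bool) : Option (Fin N → Bool) → ℝ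
  | none => e x
  | some z => (1 - e x) * μ z

theorem stateProb_nonneg {μ e : (Fin N → Bool) → ℝ} (hμ : ∀ z, 0 ≤ μ z)
    (he : ∀ x, 0 ≤ e x ∧ e x ≤ 1) (x : Fin N → Bool) (s : Option (Fin N → Bool)) :
    0 ≤ stateProb μ e x s := by
  cases s with
  | none => exact (he x).1
  | some z => exact mul_nonneg (sub_nonneg.mpr (he x).2) (hμ z)

theorem sum_stateProb {μ e : (Fin N → Bool) → ℝ} (hμ : ∑ z, μ z = 1) (x : Fin N → Bool) :
    ∑ s, stateProb μ e x s = 1 := by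
  rw [Fintype.sum_option]
  simp [stateProb, ← Finset.mul_sum, hμ]

/-- The output is a function of input and state, so its law is a push-forward of the state law. -/
theorem trans_eq_sum_stateProb (A β γ : ℝ) (e : (Fin N → Bool) → ℝ) (x : Fin N → Bool)
    (y : Option (Fin N → Bool)) :
    trans A β γ e x y =
      ∑ s, if s.map (output x) = y then stateProb (noiseLaw A β γ N) e x s else 0 := by
  rw [Fintype.sum_option]
  cases y with
  | none => simp [trans, stateProb]
  | some y =>
    simp only [trans, stateProb, Option.map_none, reduceCtorEq, if_false, Option.map_some,
      Option.some.injEq, zero_add]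
    rw [← sum_noiseLaw_filter A β γ (fun z => output x z = y), Finset.mul_sum]
    exact Finset.sum_congr rfl fun z _ => by split_ifs <;> simp

/-- What the decoder of bit-pipe `i` sees when the carry-over bits have been subtracted
correctly. -/
def pipeOutput (x : Fin N → Bool) (i : Fin N) (s : Option (Fin N → Bool)) : Option Bool :=
  s.map fun z => xor (x i) (z i)

/-- The error probability of the decoder `d` of bit-pipe `i` for the transmitted sequence `x` and
the message `j`, when the carry-over bits have been subtracted correctly. -/
noncomputable def pipeError (μ e : (Fin N → Bool) → ℝ) (x : Fin n → Fin N → Bool) (i : Fin N) {K : ℕ}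
    (d : (Fin n → Option Bool) → Fin K) (j : Fin K) : ℝ :=
  ∑ s : Fin n → Option (Fin N → Bool), (∏ t, stateProb μ e (x t) (s t)) *
    if d (fun t => pipeOutput (x t) i (s t)) = j then 0 else 1

theorem pipeError_nonneg {μ e : (Fin N → Bool) → ℝ} (hμ : ∀ z, 0 ≤ μ z)
    (he : ∀ x, 0 ≤ e x ∧ e x ≤ 1) (x : Fin n → Fin N → Bool) (i : Fin N) {K : ℕ}
    (d : (Fin n → Option Bool) → Fin K) (j : Fin K) : 0 ≤ pipeError μ e x i d j :=
  Finset.sum_nonneg fun s _ => mul_nonneg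
    (Finset.prod_nonneg fun _ _ => stateProb_nonneg hμ he _ _) (by split_ifs <;> norm_num)

theorem pipeError_le_one {μ e : (Fin N → Bool) → ℝ} (hμ : ∀ z, 0 ≤ μ z) (hμ1 : ∑ z, μ z = 1)
    (he : ∀ x, 0 ≤ e x ∧ e x ≤ 1) (x : Fin n → Fin N → Bool) (i : Fin N) {K : ℕ}
    (d : (Fin n → Option Bool) → Fin K) (j : Fin K) : pipeError μ e x i d j ≤ 1 :=
  sum_prod_mul_le (κ := fun _ : Fin n => Option (Fin N → Bool)) (fun t => stateProb μ e (x t))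
    (fun _ _ => stateProb_nonneg hμ he _ _) (fun _ => sum_stateProb hμ1 _) _ 1
    (fun s => by split_ifs <;> norm_num)

/-- With an erasure probability that does not depend on the input, only the codeword of the
bit-pipe matters. -/
theorem pipeError_congr {μ e : (Fin N → Bool) → ℝ} (he : ∀ x x', e x = e x')
    {x x' : Fin n → Fin N → Bool} {i : Fin N} (hx : ∀ t, x t i = x' t i) {K : ℕ}
    (d : (Fin n → Option Bool) → Fin K) (j : Fin K) :
    pipeError μ e x i d j = pipeError μ e x' i d j := by
  have h : ∀ t s, stateProb μ e (x t) s = stateProb μ e (x' t) s := by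
    intro t s
    cases s <;> simp [stateProb, he (x t) (x' t)]
  have h' : ∀ t s, pipeOutput (x t) i s = pipeOutput (x' t) i s := by
    intro t s
    rw [pipeOutput, pipeOutput, hx t]
  simp only [pipeError, h', h]

namespace IDCode

variable {M : Fin N → ℕ}

/-- The carry only has to be right at unerased times; the erased symbols ignore it. -/
theorem cleaned_output (C : IDCode N n M) (m : (i : Fin N) → Fin (M i))
    (s : Fin n → Option (Fin N → Bool)) (i : Fin N) (w : Fin n → Bool)
    (hw : ∀ t z, s t = some z → w t = carry (C.input m t) z i) :
    cleaned (fun t => (s t).map (output (C.input m t))) i w =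
      fun t => pipeOutput (C.input m t) i (s t) := by
  funext t
  simp only [cleaned, pipeOutput]
  cases hs : s t with
  | none => rfl
  | some z => simp [output, hw t z hs]

/-- Induction along the bit-pipes: a correct decision re-encodes to the input bits, adding these to
the cleaned output leaves the noise bits, and the receiver then runs the carry recursion of the
channel. -/
theorem carryEst_eq (C : IDCode N n M) (m : (i : Fin N) → Fin (M i))
    (s : Fin n → Option (Fin N → Bool))
    (hd : ∀ i, C.dec i (fun t => pipeOutput (C.input m t) i (s t)) = m i) (i : ℕ) :
    ∀ t z, s t = some z →
      C.carryEst (fun t => (s t).map (output (C.input m t))) i t = carry (C.input m t) z i := by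
  induction i with
  | zero => intro t z _; rfl
  | succ i ih =>
    intro t z hs
    simp only [carryEst, carry]
    split_ifs with h
    · rw [C.cleaned_output m s ⟨i, h⟩ _ ih, hd]
      simp only [pipeOutput, hs, Option.map_some, ih t z hs]
      have hx : ∀ a b : Bool, xor (xor a b) a = b := by decide
      simp only [input, hx]
    · rfl

theorem decode_eq (C : IDCode N n M) (m : (i : Fin N) → Fin (M i))
    (s : Fin n → Option (Fin N → Bool))
    (hd : ∀ i, C.dec i (fun t => pipeOutput (C.input m t) i (s t)) = m i) :
    C.decode (fun t => (s t).map (output (C.input m t))) = m := by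
  funext i
  rw [decode, C.cleaned_output m s i _ (C.carryEst_eq m s hd i), hd]

/-- Summing over states instead of outputs puts the actual receiver and the one with known carries
on a common probability space. -/
theorem errorProb_eq (A β γ : ℝ) (e : (Fin N → Bool) → ℝ) (C : IDCode N n M)
    (m : (i : Fin N) → Fin (M i)) :
    C.errorProb A β γ e m = ∑ s : Fin n → Option (Fin N → Bool),
      (∏ t, stateProb (noiseLaw A β γ N) e (C.input m t) (s t)) *
        if C.decode (fun t => (s t).map (output (C.input m t))) = m then 0 else 1 := by
  have h : ∀ y : Fin n → Option (Fin N → Bool), ∏ t, trans A β γ e (C.input m t) (y t) =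
      ∑ s : Fin n → Option (Fin N → Bool),
        if (fun t => (s t).map (output (C.input m t))) = y then
          ∏ t, stateProb (noiseLaw A β γ N) e (C.input m t) (s t) else 0 := by
    intro y
    simp_rw [trans_eq_sum_stateProb]
    rw [← sum_prod_pi (κ := fun _ : Fin n => Option (Fin N → Bool))
      (fun t s => if s.map (output (C.input m t)) = y t then
        stateProb (noiseLaw A β γ N) e (C.input m t) s else 0)]
    refine Finset.sum_congr rfl fun s _ => ?_
    split_ifs with hs
    · exact Finset.prod_congr rfl fun t _ => if_pos (congrFun hs t)
    · obtain ⟨t, ht⟩ := Function.ne_iff.mp hs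
      exact Finset.prod_eq_zero (Finset.mem_univ t) (if_neg ht)
  unfold errorProb
  simp_rw [h]
  have h' : ∀ y : Fin n → Option (Fin N → Bool), (if C.decode y = m then 0 else
      ∑ s : Fin n → Option (Fin N → Bool),
        if (fun t => (s t).map (output (C.input m t))) = y then
          ∏ t, stateProb (noiseLaw A β γ N) e (C.input m t) (s t) else 0) =
      ∑ s : Fin n → Option (Fin N → Bool),
        if (fun t => (s t).map (output (C.input m t))) = y then
          (∏ t, stateProb (noiseLaw A β γ N) e (C.input m t) (s t)) *
            (if C.decode (fun t => (s t).map (output (C.input m t))) = m then 0 else 1)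
          else 0 := by
    intro y
    split_ifs with hy
    · exact (Finset.sum_eq_zero fun s _ => by
        by_cases hs : (fun t => (s t).map (output (C.input m t))) = y
        · rw [if_pos hs, hs, if_pos hy, mul_zero]
        · rw [if_neg hs]).symm
    · refine Finset.sum_congr rfl fun s _ => ?_
      by_cases hs : (fun t => (s t).map (output (C.input m t))) = y
      · rw [if_pos hs, if_pos hs, hs, if_neg hy, mul_one]
      · rw [if_neg hs, if_neg hs]
  calc _ = _ := Finset.sum_congr rfl fun y _ => by convert h' y
    _ = _ := by
      rw [Finset.sum_comm]
      exact Finset.sum_congr rfl fun s _ => by simp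

/-- The error probability of successive decoding is at most the sum of the error probabilities of
the bit-pipes with correctly subtracted carry-over bits. -/
theorem errorProb_le (A β γ : ℝ) (hA : 0 < A) (hβ : 0 < β) (hγ : 0 < γ)
    (e : (Fin N → Bool) → ℝ) (he : ∀ x, 0 ≤ e x ∧ e x ≤ 1) (C : IDCode N n M)
    (m : (i : Fin N) → Fin (M i)) :
    C.errorProb A β γ e m ≤
      ∑ i, pipeError (noiseLaw A β γ N) e (C.input m) i (C.dec i) (m i) := by
  rw [errorProb_eq]
  simp only [pipeError]
  rw [Finset.sum_comm]
  refine Finset.sum_le_sum fun s _ => ?_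
  rw [← Finset.mul_sum]
  refine mul_le_mul_of_nonneg_left ?_ (Finset.prod_nonneg fun _ _ =>
    stateProb_nonneg (noiseLaw_nonneg hA hβ hγ) he _ _)
  have h0 : ∀ i : Fin N, (0 : ℝ) ≤
      if C.dec i (fun t => pipeOutput (C.input m t) i (s t)) = m i then 0 else 1 := by
    intro i; split_ifs <;> norm_num
  by_cases hd : ∀ i, C.dec i (fun t => pipeOutput (C.input m t) i (s t)) = m i
  · rw [if_pos (C.decode_eq m s hd)]
    exact Finset.sum_nonneg fun i _ => h0 i
  · push Not at hd
    obtain ⟨i, hi⟩ := hd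
    refine le_trans ?_ (Finset.single_le_sum (fun i _ => h0 i) (Finset.mem_univ i))
    rw [if_neg hi]
    split_ifs <;> norm_num

end IDCode

end VBC

namespace VBC

/-! ### The information density of a bit-pipe -/

/-- The Bernoulli distribution on bits. -/
noncomputable def bern (p : ℝ) (b : Bool) : ℝ := if b then p else 1 - p

theorem bern_nonneg {p : ℝ} (h0 : 0 ≤ p) (h1 : p ≤ 1) (b : Bool) : 0 ≤ bern p b := by
  cases b <;> simp [bern] <;> linarith

theorem bern_pos {p : ℝ} (h0 : 0 < p) (h1 : p < 1) (b : Bool) : 0 < bern p b := by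
  cases b <;> simp [bern] <;> linarith

theorem sum_bern (p : ℝ) : ∑ b, bern p b = 1 := by
  simp [bern]

theorem bconv_pos {p a : ℝ} (h0 : 0 ≤ p) (h1 : p ≤ 1) (ha0 : 0 < a) (ha1 : a < 1) :
    0 < bconv p a := by
  unfold bconv
  rcases h0.eq_or_lt with rfl | h
  · simpa using ha0
  · nlinarith [mul_pos h (sub_pos.mpr ha1), mul_nonneg (sub_nonneg.mpr h1) ha0.le]

theorem bconv_lt_one {p a : ℝ} (h0 : 0 ≤ p) (h1 : p ≤ 1) (ha0 : 0 < a) (ha1 : a < 1) :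
    bconv p a < 1 := by
  have := bconv_pos h0 h1 (sub_pos.mpr ha1) (by linarith : 1 - a < 1)
  unfold bconv at this ⊢
  linarith

/-- The information density between a bit and its noisy version; erasures contribute nothing. -/
noncomputable def infoDensity (p a : ℝ) (b : Bool) : Option Bool → ℝ
  | none => 0
  | some v => Real.log (bern a (xor v b) / bern (bconv p a) v)

/-- The divergence of the output distribution for the input bit `b` from the average output
distribution. -/
noncomputable def divergence (p a : ℝ) (b : Bool) : ℝ :=
  ∑ z, bern a z * infoDensity p a b (some (xor b z))

section

variable {p a : ℝ} (h0 : 0 ≤ p) (h1 : p ≤ 1) (ha0 : 0 < a) (ha1 : a < 1)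

include h0 h1 ha0 ha1

/-- For a fixed output, averaging the transition probability over the input gives the output
probability, which is the denominator of the ratio. -/
theorem sum_bern_mul_exp_infoDensity (y : Option Bool) :
    ∑ b, bern p b * Real.exp (infoDensity p a b y) = 1 := by
  cases y with
  | none => simp [infoDensity, bern]
  | some v =>
    have hq := bern_pos (bconv_pos h0 h1 ha0 ha1) (bconv_lt_one h0 h1 ha0 ha1) v
    have : ∀ b, Real.exp (infoDensity p a b (some v)) =
        bern a (xor v b) / bern (bconv p a) v := fun b =>
      Real.exp_log (div_pos (bern_pos ha0 ha1 _) hq)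
    simp_rw [this, ← mul_div_assoc]
    rw [← Finset.sum_div, div_eq_one_iff_eq hq.ne']
    cases v
    · simp [bern, bconv]; ring
    · simp [bern, bconv]

/-- Gibbs' inequality from `log u ≥ 1 - 1 / u`. It is needed for each input bit separately, because
the erasure probability may depend on the input. -/
theorem divergence_nonneg (b : Bool) : 0 ≤ divergence p a b := by
  have hq := bern_pos (bconv_pos h0 h1 ha0 ha1) (bconv_lt_one h0 h1 ha0 ha1)
  have hx : ∀ z, xor (xor b z) b = z := by cases b <;> decide
  have h : ∀ z, bern a z - bern (bconv p a) (xor b z) ≤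
      bern a z * infoDensity p a b (some (xor b z)) := by
    intro z
    have hz := bern_pos ha0 ha1 z
    have := Real.one_sub_inv_le_log_of_pos (div_pos hz (hq (xor b z)))
    simp only [infoDensity, hx]
    calc _ = bern a z * (1 - (bern a z / bern (bconv p a) (xor b z))⁻¹) := by field_simp
      _ ≤ _ := mul_le_mul_of_nonneg_left this hz.le
  refine le_trans (le_of_eq ?_) (Finset.sum_le_sum fun z _ => h z)
  cases b <;> simp [bern]

/-- The mean divergence from the output law is the mutual information, output entropy minus noise
entropy. -/
theorem sum_bern_mul_divergence :
    ∑ b, bern p b * divergence p a b = Real.binEntropy (bconv p a) - Real.binEntropy a := by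
  have hq0 := bconv_pos h0 h1 ha0 ha1
  have hq1 := sub_pos.mpr (bconv_lt_one h0 h1 ha0 ha1)
  have ha1' := sub_pos.mpr ha1
  simp only [divergence, infoDensity, bern, Fintype.sum_bool, Bool.xor_true, Bool.xor_false,
    Bool.not_true, Bool.not_false, if_true, Bool.false_eq_true, if_false]
  rw [Real.log_div ha0.ne' hq0.ne', Real.log_div ha0.ne' hq1.ne', Real.log_div ha1'.ne' hq0.ne',
    Real.log_div ha1'.ne' hq1.ne']
  simp only [Real.binEntropy, Real.log_inv]
  have : 1 - bconv p a = p * a + (1 - p) * (1 - a) := by unfold bconv; ring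
  generalize Real.log (1 - bconv p a) = L1
  rw [this]
  generalize Real.log (bconv p a) = L2
  unfold bconv
  ring

end

/-! ### Threshold decoding -/

variable {N n : ℕ}

open Classical in
/-- The decoder that chooses a codeword whose information density with the observed sequence is
at least `r`. -/
noncomputable def thresholdDecoder {K : ℕ} (hK : 0 < K) (f : Bool → Option Bool → ℝ) (r : ℝ)
    (c : Fin K → Fin n → Bool) (y : Fin n → Option Bool) : Fin K :=
  if h : ∃ j, r ≤ ∑ t, f (c j t) (y t) then h.choose else ⟨0, hK⟩

/-- An error requires that the true codeword misses the threshold or that a wrong one reaches it.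
Both indicators are bounded by exponentials: the first with a free exponent `l`, the second with
exponent one, where the expected likelihood ratio is known exactly. -/
theorem thresholdDecoder_error_le {K : ℕ} (hK : 0 < K) (f : Bool → Option Bool → ℝ) (r l : ℝ)
    (hl : 0 ≤ l) (c : Fin K → Fin n → Bool) (y : Fin n → Option Bool) (j : Fin K) :
    (if thresholdDecoder hK f r c y = j then (0 : ℝ) else 1) ≤
      Real.exp (l * (r - ∑ t, f (c j t) (y t))) +
        ∑ j' ∈ Finset.univ.erase j, Real.exp (∑ t, f (c j' t) (y t) - r) := by
  have hs : ∀ j' ∈ Finset.univ.erase j, 0 ≤ Real.exp (∑ t, f (c j' t) (y t) - r) :=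
    fun _ _ => (Real.exp_pos _).le
  have hnn := Finset.sum_nonneg hs
  split_ifs with hd
  · exact add_nonneg (Real.exp_pos _).le hnn
  · by_cases hj : r ≤ ∑ t, f (c j t) (y t)
    · have hex : ∃ j, r ≤ ∑ t, f (c j t) (y t) := ⟨j, hj⟩
      rw [thresholdDecoder, dif_pos hex] at hd
      have h1 := Finset.single_le_sum hs (Finset.mem_erase.mpr ⟨hd, Finset.mem_univ _⟩)
      have h2 := Real.one_le_exp (sub_nonneg.mpr hex.choose_spec)
      linarith [Real.exp_pos (l * (r - ∑ t, f (c j t) (y t)))]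
    · have := Real.one_le_exp (mul_nonneg hl (sub_nonneg.mpr (not_le.mp hj).le))
      linarith

/-! ### Random coding -/

variable {p : Fin N → ℝ} {μ e : (Fin N → Bool) → ℝ}

theorem sum_noise_marginal (hμ1 : ∑ z, μ z = 1) {i : Fin N} {a : ℝ}
    (ha : ∑ z, (if z i = true then μ z else 0) = a) (f : Bool → ℝ) :
    ∑ z, μ z * f (z i) = ∑ b, bern a b * f b := by
  -- A function of one bit is affine in the indicator of that bit.
  have h : ∀ z : Fin N → Bool,
      μ z * f (z i) = (if z i = true then μ z else 0) * (f true - f false) + μ z * f false := by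
    intro z
    cases z i <;> simp
    ring
  simp_rw [h]
  rw [Finset.sum_add_distrib, ← Finset.sum_mul, ← Finset.sum_mul, ha, hμ1]
  simp [bern]
  ring

theorem sum_stateProb_mul_infoDensity (hμ1 : ∑ z, μ z = 1) {i : Fin N} {a : ℝ}
    (ha : ∑ z, (if z i = true then μ z else 0) = a) (x : Fin N → Bool) :
    ∑ s, stateProb μ e x s * infoDensity (p i) a (x i) (pipeOutput x i s) =
      (1 - e x) * divergence (p i) a (x i) := by
  rw [Fintype.sum_option]
  simp only [stateProb, pipeOutput, Option.map_none, Option.map_some, infoDensity, mul_zero,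
    zero_add, mul_assoc]
  rw [← Finset.mul_sum,
    sum_noise_marginal hμ1 ha (fun b => Real.log (bern a (xor (xor (x i) b) (x i)) /
      bern (bconv (p i) a) (xor (x i) b)))]
  rfl

theorem sum_prod_bern (p : Fin N → ℝ) : ∑ x : Fin N → Bool, ∏ i, bern (p i) (x i) = 1 :=
  sum_prod_pi_eq_one (fun i => bern (p i)) fun i => sum_bern (p i)

theorem sum_prod_bern_mul (p : Fin N → ℝ) (i : Fin N) (f : Bool → ℝ) :
    ∑ x : Fin N → Bool, (∏ i, bern (p i) (x i)) * f (x i) = ∑ b, bern (p i) b * f b := by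
  rw [sum_prod_resample (fun i => bern (p i)) (fun i => sum_bern (p i)) i]
  simp only [Function.update_self]
  rw [← Finset.sum_mul, sum_prod_bern, one_mul]

/-- Inputs that use a switched-off bit-pipe have probability zero. On all others `e x ≤ E`, and
nonnegativity of the divergence allows `1 - e x` to be replaced by `1 - E`. -/
theorem infoDensity_mean_ge (hp : ∀ i, 0 ≤ p i ∧ p i ≤ 1) (hμ1 : ∑ z, μ z = 1)
    {E : ℝ} (hE : ∀ x : Fin N → Bool, (∀ i, p i = 0 → x i = false) → e x ≤ E) {i : Fin N} {a : ℝ}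
    (ha : ∑ z, (if z i = true then μ z else 0) = a) (ha0 : 0 < a) (ha1 : a < 1) :
    (1 - E) * (Real.binEntropy (bconv (p i) a) - Real.binEntropy a) ≤
      ∑ x : Fin N → Bool, (∏ i, bern (p i) (x i)) *
        ∑ s, stateProb μ e x s * infoDensity (p i) a (x i) (pipeOutput x i s) := by
  rw [← sum_bern_mul_divergence (hp i).1 (hp i).2 ha0 ha1, ← sum_prod_bern_mul p i, Finset.mul_sum]
  refine Finset.sum_le_sum fun x _ => ?_
  rw [sum_stateProb_mul_infoDensity hμ1 ha]
  by_cases hx : ∀ i, p i = 0 → x i = false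
  · have h1 : 0 ≤ ∏ i, bern (p i) (x i) :=
      Finset.prod_nonneg fun i _ => bern_nonneg (hp i).1 (hp i).2 _
    have h2 := divergence_nonneg (hp i).1 (hp i).2 ha0 ha1 (x i)
    nlinarith [mul_nonneg (mul_nonneg h1 h2) (sub_nonneg.mpr (hE x hx))]
  · push Not at hx
    obtain ⟨i', hi', hx'⟩ := hx
    have : ∏ i, bern (p i) (x i) = 0 :=
      Finset.prod_eq_zero (Finset.mem_univ i') (by simp [bern, hi', hx'])
    rw [this]; simp

theorem codebookProb_eq {M : Fin N → ℕ} (p : Fin N → ℝ)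
    (c : (i : Fin N) → Fin (M i) → Fin n → Bool) :
    codebookProb p c = ∏ i, ∏ j, ∏ t, bern (p i) (c i j t) := rfl

theorem codebookProb_nonneg {M : Fin N → ℕ} (hp : ∀ i, 0 ≤ p i ∧ p i ≤ 1)
    (c : (i : Fin N) → Fin (M i) → Fin n → Bool) : 0 ≤ codebookProb p c :=
  Finset.prod_nonneg fun i _ => Finset.prod_nonneg fun _ _ => Finset.prod_nonneg fun _ _ =>
    bern_nonneg (hp i).1 (hp i).2 _

theorem sum_prod_bern_seq (n : ℕ) (q : ℝ) :
    ∑ u : Fin n → Bool, ∏ t, bern q (u t) = 1 :=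
  sum_prod_pi_eq_one (fun _ => bern q) fun _ => sum_bern q

/-- The expectation over the codebooks of a quantity that factorizes over time and depends on
the transmitted codewords only. -/
theorem sum_codebookProb_mul_prod {M : Fin N → ℕ} (p : Fin N → ℝ) (m : (i : Fin N) → Fin (M i))
    (H : (Fin N → Bool) → ℝ) :
    ∑ c : (i : Fin N) → Fin (M i) → Fin n → Bool,
      codebookProb p c * ∏ t, H (fun i => c i (m i) t) =
        (∑ x : Fin N → Bool, (∏ i, bern (p i) (x i)) * H x) ^ n := by
  simp only [codebookProb_eq]
  rw [sum_codebook_eval (κ := Fin n → Bool) (fun i u => ∏ t, bern (p i) (u t))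
    (fun i => sum_prod_bern_seq n (p i)) m (fun x => ∏ t, H (fun i => x i t))]
  -- Transposition: `N` independent codewords become `n` independent, identically distributed input
  -- vectors.
  rw [← Equiv.sum_comp (Equiv.piComm (fun (_ : Fin n) (_ : Fin N) => Bool))]
  have h : ∀ x : Fin n → Fin N → Bool,
      (∏ i, ∏ t, bern (p i) (Equiv.piComm (fun (_ : Fin n) (_ : Fin N) => Bool) x i t)) *
        ∏ t, H (fun i => Equiv.piComm (fun (_ : Fin n) (_ : Fin N) => Bool) x i t) =
      ∏ t, ((∏ i, bern (p i) (x t i)) * H (x t)) := by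
    intro x
    rw [Finset.prod_comm, ← Finset.prod_mul_distrib]
    rfl
  simp_rw [h]
  rw [sum_prod_pi (κ := fun _ : Fin n => Fin N → Bool)
    (fun _ x => (∏ i, bern (p i) (x i)) * H x)]
  simp

/-- For a wrong codeword the expected likelihood ratio is one. -/
theorem sum_codebookProb_wrong_le {M : Fin N → ℕ} (hp : ∀ i, 0 ≤ p i ∧ p i ≤ 1)
    (hμ : ∀ z, 0 ≤ μ z) (hμ1 : ∑ z, μ z = 1) (he : ∀ x, 0 ≤ e x ∧ e x ≤ 1)
    {i : Fin N} {a : ℝ} (ha0 : 0 < a) (ha1 : a < 1) (r : ℝ)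
    (m : (i : Fin N) → Fin (M i)) (j : Fin (M i)) (hj : j ≠ m i) :
    ∑ c : (i : Fin N) → Fin (M i) → Fin n → Bool, codebookProb p c *
      ∑ s : Fin n → Option (Fin N → Bool),
        (∏ t, stateProb μ e (fun i => c i (m i) t) (s t)) *
          Real.exp (∑ t, infoDensity (p i) a (c i j t)
            (pipeOutput (fun i => c i (m i) t) i (s t)) - r) ≤ Real.exp (-r) := by
  refine sum_codebook_le (κ := Fin n → Bool) (fun i u => ∏ t, bern (p i) (u t))
    (fun i u => Finset.prod_nonneg fun _ _ => bern_nonneg (hp i).1 (hp i).2 _)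
    (fun i => sum_prod_bern_seq n (p i)) i j _ _ ?_
  intro c
  -- Resampling the wrong codeword `j` leaves the transmitted codewords, and hence the state law,
  -- unchanged.
  have hm : ∀ (b : Fin n → Bool) (i' : Fin N),
      Function.update c i (Function.update (c i) j b) i' (m i') = c i' (m i') := by
    intro b i'
    by_cases h : i' = i
    · subst h
      rw [Function.update_self, Function.update_of_ne (Ne.symm hj)]
    · rw [Function.update_of_ne h]
  simp only [hm, Function.update_self]
  simp_rw [Finset.mul_sum]
  rw [Finset.sum_comm]
  have h : ∀ s : Fin n → Option (Fin N → Bool),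
      ∑ b : Fin n → Bool, (∏ t, bern (p i) (b t)) *
        ((∏ t, stateProb μ e (fun i => c i (m i) t) (s t)) *
          Real.exp (∑ t, infoDensity (p i) a (b t)
            (pipeOutput (fun i => c i (m i) t) i (s t)) - r)) =
      (∏ t, stateProb μ e (fun i => c i (m i) t) (s t)) * Real.exp (-r) := by
    intro s
    have h' : ∀ b : Fin n → Bool, (∏ t, bern (p i) (b t)) *
        ((∏ t, stateProb μ e (fun i => c i (m i) t) (s t)) *
          Real.exp (∑ t, infoDensity (p i) a (b t)
            (pipeOutput (fun i => c i (m i) t) i (s t)) - r)) =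
        (∏ t, stateProb μ e (fun i => c i (m i) t) (s t)) * Real.exp (-r) *
          ∏ t, (bern (p i) (b t) * Real.exp (infoDensity (p i) a (b t)
            (pipeOutput (fun i => c i (m i) t) i (s t)))) := by
      intro b
      rw [sub_eq_add_neg, Real.exp_add, Real.exp_sum, Finset.prod_mul_distrib]
      ring
    simp_rw [h']
    rw [← Finset.mul_sum, sum_prod_pi (κ := fun _ : Fin n => Bool)
      (fun t b => bern (p i) b * Real.exp (infoDensity (p i) a b
            (pipeOutput (fun i => c i (m i) t) i (s t))))]
    simp only [sum_bern_mul_exp_infoDensity (hp i).1 (hp i).2 ha0 ha1, Finset.prod_const_one,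
      mul_one]
  rw [Finset.sum_congr rfl fun s _ => h s]
  exact sum_prod_mul_le (κ := fun _ : Fin n => Option (Fin N → Bool))
    (fun t => stateProb μ e (fun i => c i (m i) t))
    (fun _ _ => stateProb_nonneg hμ he _ _) (fun _ => sum_stateProb hμ1 _) _ _ fun _ => le_rfl

theorem sum_codebookProb (p : Fin N → ℝ) (n : ℕ) (M : Fin N → ℕ) :
    ∑ c : (i : Fin N) → Fin (M i) → Fin n → Bool, codebookProb p c = 1 :=
  sum_prod_pi_eq_one (κ := fun i => Fin (M i) → Fin n → Bool)
    (fun i d => ∏ j, ∏ t, bern (p i) (d j t)) fun i =>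
      sum_prod_pi_eq_one (κ := fun _ : Fin (M i) => Fin n → Bool)
        (fun _ u => ∏ t, bern (p i) (u t)) fun _ => sum_prod_bern_seq n (p i)

theorem exists_decoder (hp : ∀ i, 0 ≤ p i ∧ p i ≤ 1)
    (hμ : ∀ z, 0 ≤ μ z) (hμ1 : ∑ z, μ z = 1) (he : ∀ x, 0 ≤ e x ∧ e x ≤ 1)
    {E : ℝ} (hE : ∀ x : Fin N → Bool, (∀ i, p i = 0 → x i = false) → e x ≤ E) {i : Fin N} {a : ℝ}
    (ha : ∑ z, (if z i = true then μ z else 0) = a) (ha0 : 0 < a) (ha1 : a < 1) {r : ℝ}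
    (hr : r < (1 - E) * (Real.binEntropy (bconv (p i) a) - Real.binEntropy a)) :
    ∃ ρ, 0 ≤ ρ ∧ ρ < 1 ∧ ∀ (n : ℕ) (M : Fin N → ℕ), 0 < M i →
      ∃ D : (Fin (M i) → Fin n → Bool) → (Fin n → Option Bool) → Fin (M i),
        ∀ m : (i : Fin N) → Fin (M i),
          ∑ c : (i : Fin N) → Fin (M i) → Fin n → Bool, codebookProb p c *
            pipeError μ e (fun t i => c i (m i) t) i (D (c i)) (m i) ≤
              ρ ^ n + (M i - 1) * Real.exp (-(n * r)) := by
  have hb : ∀ x : Fin N → Bool, 0 ≤ ∏ i, bern (p i) (x i) := fun x =>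
    Finset.prod_nonneg fun i _ => bern_nonneg (hp i).1 (hp i).2 _
  have hmean := infoDensity_mean_ge hp hμ1 hE ha ha0 ha1
  -- Chernoff exponent for `r` minus the density, whose mean is negative by the choice of `r`. The
  -- moment serves as `ρ`.
  obtain ⟨l, hl, hlt⟩ := exists_exp_moment_lt_one
    (S := (Fin N → Bool) × Option (Fin N → Bool))
    (fun q => (∏ i, bern (p i) (q.1 i)) * stateProb μ e q.1 q.2)
    (fun q => r - infoDensity (p i) a (q.1 i) (pipeOutput q.1 i q.2))
    (by
      rw [Fintype.sum_prod_type]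
      simp only [← Finset.mul_sum, sum_stateProb hμ1, mul_one, sum_prod_bern])
    (by
      rw [Fintype.sum_prod_type]
      simp only [mul_sub, Finset.sum_sub_distrib, mul_assoc, ← Finset.mul_sum]
      simp only [← Finset.sum_mul, sum_stateProb hμ1, one_mul, sum_prod_bern]
      linarith)
  rw [Fintype.sum_prod_type] at hlt
  simp only [mul_assoc, ← Finset.mul_sum] at hlt
  refine ⟨_, ?_, hlt, ?_⟩
  · exact Finset.sum_nonneg fun x _ => mul_nonneg (hb x) (Finset.sum_nonneg fun s _ =>
      mul_nonneg (stateProb_nonneg hμ he _ _) (Real.exp_pos _).le)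
  intro n M hM
  refine ⟨thresholdDecoder hM (infoDensity (p i) a) (n * r), fun m => ?_⟩
  have hc : ∀ c : (i : Fin N) → Fin (M i) → Fin n → Bool, 0 ≤ codebookProb p c :=
    codebookProb_nonneg hp
  have hpe : ∀ c : (i : Fin N) → Fin (M i) → Fin n → Bool,
      pipeError μ e (fun t i => c i (m i) t) i
        (thresholdDecoder hM (infoDensity (p i) a) (n * r) (c i)) (m i) ≤
      ∏ t : Fin n, (∑ s, stateProb μ e (fun i => c i (m i) t) s *
          Real.exp (l * (r - infoDensity (p i) a (c i (m i) t)
            (pipeOutput (fun i => c i (m i) t) i s)))) +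
      ∑ j ∈ Finset.univ.erase (m i), ∑ s : Fin n → Option (Fin N → Bool),
        (∏ t, stateProb μ e (fun i => c i (m i) t) (s t)) *
          Real.exp (∑ t, infoDensity (p i) a (c i j t)
            (pipeOutput (fun i => c i (m i) t) i (s t)) - n * r) := by
    intro c
    rw [← sum_prod_pi (κ := fun _ : Fin n => Option (Fin N → Bool)), Finset.sum_comm,
      ← Finset.sum_add_distrib]
    refine Finset.sum_le_sum fun s _ => ?_
    rw [Finset.prod_mul_distrib, ← Finset.mul_sum, ← mul_add]
    refine mul_le_mul_of_nonneg_left ?_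
      (Finset.prod_nonneg fun _ _ => stateProb_nonneg hμ he _ _)
    refine (thresholdDecoder_error_le hM (infoDensity (p i) a) (n * r) l hl.le (c i) _
      (m i)).trans (le_of_eq ?_)
    congr 1
    rw [← Real.exp_sum, ← Finset.mul_sum, Finset.sum_sub_distrib]
    simp
  refine (Finset.sum_le_sum fun c _ => mul_le_mul_of_nonneg_left (hpe c) (hc c)).trans ?_
  simp only [mul_add, Finset.sum_add_distrib]
  refine add_le_add (le_of_eq ?_) ?_
  · exact sum_codebookProb_mul_prod p m (fun x => ∑ s, stateProb μ e x s *
      Real.exp (l * (r - infoDensity (p i) a (x i) (pipeOutput x i s))))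
  · simp_rw [Finset.mul_sum (Finset.univ.erase (m i))]
    rw [Finset.sum_comm]
    refine (Finset.sum_le_card_nsmul _ _ (Real.exp (-(n * r))) fun j hj => ?_).trans (le_of_eq ?_)
    · exact sum_codebookProb_wrong_le hp hμ hμ1 he ha0 ha1 _ m j (Finset.ne_of_mem_erase hj)
    · rw [Finset.card_erase_of_mem (Finset.mem_univ _), Finset.card_univ, Fintype.card_fin,
        nsmul_eq_mul, Nat.cast_pred hM]

end VBC

namespace VBC

open Filter Topology

variable {N : ℕ}

/-! ### Codebook sizes -/

/-- The number of messages of rate `r` in nats. -/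
noncomputable def codeSize (n : ℕ) (r : ℝ) : ℕ := ⌈Real.exp (n * r)⌉₊

theorem codeSize_pos (n : ℕ) (r : ℝ) : 0 < codeSize n r := Nat.ceil_pos.mpr (Real.exp_pos _)

theorem codeSize_sub_one_le (n : ℕ) (r : ℝ) : (codeSize n r : ℝ) - 1 ≤ Real.exp (n * r) := by
  linarith [Nat.ceil_lt_add_one (Real.exp_pos (n * r)).le, show (codeSize n r : ℝ) =
    (⌈Real.exp (n * r)⌉₊ : ℝ) from rfl]

/-- Keeps switched-off bit-pipes silent: their rate with margin is negative. -/
theorem codeSize_eq_one (n : ℕ) {r : ℝ} (hr : r ≤ 0) : codeSize n r = 1 := by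
  refine le_antisymm (Nat.ceil_le.mpr ?_) (codeSize_pos n r)
  simpa using mul_nonpos_of_nonneg_of_nonpos n.cast_nonneg hr

theorem le_logb_codeSize (n : ℕ) (r : ℝ) :
    n * (r / Real.log 2) ≤ Real.logb 2 (codeSize n r) := by
  have h2 : 0 < Real.log 2 := Real.log_pos (by norm_num)
  rw [Real.logb, mul_div_assoc']
  refine div_le_div_of_nonneg_right ?_ h2.le
  rw [Real.le_log_iff_exp_le (by exact_mod_cast codeSize_pos n r)]
  exact Nat.le_ceil _

/-- `a` is a loss in bits per bit-pipe: `0` for full codebooks, `1` when they are halved. -/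
theorem le_rate {n : ℕ} (hn : 0 < n) (M : Fin N → ℕ) (r : Fin N → ℝ) (a : ℝ)
    (h : ∀ i, n * (r i / Real.log 2) - a ≤ Real.logb 2 (M i)) :
    (∑ i, r i) / Real.log 2 - N * (a / n) ≤ IDCode.rate n M := by
  have hn' : (0 : ℝ) < n := by exact_mod_cast hn
  calc _ = ∑ i, (n * (r i / Real.log 2) - a) / n := by
        simp only [sub_div, mul_div_cancel_left₀ _ hn'.ne', Finset.sum_sub_distrib,
          Finset.sum_div, Finset.sum_const, Finset.card_univ, Fintype.card_fin, nsmul_eq_mul]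
    _ ≤ _ := Finset.sum_le_sum fun i _ => div_le_div_of_nonneg_right (h i) hn'.le

/-- The rate of bit-pipe `i` in nats, with a margin `d`. -/
noncomputable def pipeRate (A β γ : ℝ) (p : Fin N → ℝ) (E d : ℝ) (i : Fin N) : ℝ :=
  (1 - E) * (Real.binEntropy (bconv (p i) (crossover A β γ N i)) -
    Real.binEntropy (crossover A β γ N i)) - d

theorem sum_pipeRate (A β γ : ℝ) (p : Fin N → ℝ) (E d : ℝ) :
    (∑ i, pipeRate A β γ p E d i) / Real.log 2 =
      (1 - E) * sumRate A β γ p - N * (d / Real.log 2) := by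
  simp only [pipeRate, sumRate, binEnt, Finset.sum_sub_distrib, ← Finset.mul_sum,
    Finset.sum_const, Finset.card_univ, Fintype.card_fin, nsmul_eq_mul, ← Finset.sum_div]
  ring

/-! ### Average performance of random codebooks -/

section

variable {A β γ : ℝ} (hA : 0 < A) (hβ : 0 < β) (hγ : 0 < γ) {e : (Fin N → Bool) → ℝ}
  (he : ∀ x, 0 ≤ e x ∧ e x ≤ 1)

include hA hβ hγ he

theorem eventually_exists_decoders {p : Fin N → ℝ} (hp : ∀ i, 0 ≤ p i ∧ p i ≤ 1) {E : ℝ}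
    (hE : ∀ x : Fin N → Bool, (∀ i, p i = 0 → x i = false) → e x ≤ E) {d ε : ℝ} (hd : 0 < d)
    (hε : 0 < ε) :
    ∀ᶠ n : ℕ in atTop, ∀ M : Fin N → ℕ, (∀ i, M i = codeSize n (pipeRate A β γ p E d i)) →
      ∃ D : (i : Fin N) → (Fin (M i) → Fin n → Bool) → (Fin n → Option Bool) → Fin (M i),
        ∀ i (m : (i : Fin N) → Fin (M i)),
          ∑ c : (i : Fin N) → Fin (M i) → Fin n → Bool, codebookProb p c *
            pipeError (noiseLaw A β γ N) e (fun t i => c i (m i) t) i (D i (c i)) (m i) ≤ ε := by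
  have key : ∀ i : Fin N, ∀ᶠ n : ℕ in atTop, ∀ M : Fin N → ℕ,
      (∀ i, M i = codeSize n (pipeRate A β γ p E d i)) →
      ∃ D : (Fin (M i) → Fin n → Bool) → (Fin n → Option Bool) → Fin (M i),
        ∀ m : (i : Fin N) → Fin (M i),
          ∑ c : (i : Fin N) → Fin (M i) → Fin n → Bool, codebookProb p c *
            pipeError (noiseLaw A β γ N) e (fun t i => c i (m i) t) i (D (c i)) (m i) ≤ ε := by
    intro i
    -- The threshold lies midway between the code rate and the lower bound on the mean density; the
    -- wrong codewords then contribute at most `exp (-(d / 2)) ^ n`.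
    obtain ⟨ρ, h0, h1, H⟩ := exists_decoder (r := pipeRate A β γ p E d i + d / 2) hp
      (noiseLaw_nonneg hA hβ hγ) (sum_noiseLaw hA hβ hγ N) he hE
      (sum_noiseLaw_eq_crossover A β γ i) (crossover_pos hA hβ hγ i) (crossover_lt_one hA hβ hγ i)
      (by unfold pipeRate; linarith)
    have hlim : Tendsto (fun n : ℕ => ρ ^ n + Real.exp (-(d / 2)) ^ n) atTop (𝓝 0) := by
      have h2 := tendsto_pow_atTop_nhds_zero_of_lt_one (Real.exp_pos (-(d / 2))).le
        (Real.exp_lt_one_iff.mpr (by linarith))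
      simpa using (tendsto_pow_atTop_nhds_zero_of_lt_one h0 h1).add h2
    filter_upwards [hlim.eventually (gt_mem_nhds hε)] with n hn M hM
    obtain ⟨D, hD⟩ := H n M (by rw [hM]; exact codeSize_pos _ _)
    refine ⟨D, fun m => (hD m).trans (le_trans ?_ hn.le)⟩
    gcongr
    rw [hM i]
    calc _ ≤ Real.exp (n * pipeRate A β γ p E d i) *
          Real.exp (-(n * (pipeRate A β γ p E d i + d / 2))) :=
          mul_le_mul_of_nonneg_right (codeSize_sub_one_le _ _) (Real.exp_pos _).le
      _ = _ := by rw [← Real.exp_add, ← Real.exp_nat_mul]; congr 1; ring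
  filter_upwards [eventually_all.mpr key] with n hn M hM
  choose D hD using fun i => hn i M hM
  exact ⟨D, hD⟩

/-- The ensemble of independent decoding with random codebooks. -/
theorem ensembleAchieves {p : Fin N → ℝ} (hp : ∀ i, 0 ≤ p i ∧ p i ≤ 1) {E : ℝ}
    (hE : ∀ x : Fin N → Bool, (∀ i, p i = 0 → x i = false) → e x ≤ E) :
    EnsembleAchieves A β γ e p ((1 - E) * sumRate A β γ p) := by
  intro δ hδ
  have h2 : 0 < Real.log 2 := Real.log_pos (by norm_num)
  have hN : (0 : ℝ) < N + 1 := by positivity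
  -- The margin is `δ / (N + 1)` in bits, so that rate losses and errors both total at most `δ` over
  -- the `N` bit-pipes.
  have hev := eventually_exists_decoders hA hβ hγ he hp hE
    (d := δ * Real.log 2 / (N + 1)) (ε := δ / (N + 1)) (by positivity) (by positivity)
  obtain ⟨n₀, hn₀⟩ := eventually_atTop.mp (hev.and (eventually_gt_atTop 0))
  refine ⟨n₀, fun n hn => ?_⟩
  obtain ⟨hD, hn0⟩ := hn₀ n hn
  obtain ⟨M, hM⟩ : ∃ M : Fin N → ℕ,
    ∀ i, M i = codeSize n (pipeRate A β γ p E (δ * Real.log 2 / (N + 1)) i) := ⟨_, fun _ => rfl⟩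
  obtain ⟨D, hD⟩ := hD M hM
  have hNδ : N * (δ / (N + 1)) ≤ δ := by
    rw [mul_div_assoc', div_le_iff₀ hN]; nlinarith
  refine ⟨M, fun i => ?_, fun i hi => ?_, ?_, D, fun m => ?_⟩
  · rw [hM]; exact codeSize_pos _ _
  · rw [hM]
    have : 0 < δ * Real.log 2 / (N + 1) := by positivity
    exact codeSize_eq_one _ (by simp [pipeRate, hi, bconv, this.le])
  · have := le_rate hn0 M (pipeRate A β γ p E (δ * Real.log 2 / (N + 1))) 0 fun i => by
      rw [hM, sub_zero]
      exact le_logb_codeSize _ _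
    rw [sum_pipeRate] at this
    refine le_trans ?_ this
    have : δ * Real.log 2 / (N + 1) / Real.log 2 = δ / (N + 1) := by field_simp
    rw [this]
    simp only [zero_div, mul_zero, sub_zero]
    linarith
  · refine le_trans ?_ hNδ
    have hc : ∀ c : (i : Fin N) → Fin (M i) → Fin n → Bool, 0 ≤ codebookProb p c :=
      codebookProb_nonneg hp
    have h : ∀ c : (i : Fin N) → Fin (M i) → Fin n → Bool,
        (IDCode.mk c (fun i => D i (c i))).errorProb A β γ e m ≤
          ∑ i, pipeError (noiseLaw A β γ N) e (fun t i => c i (m i) t) i (D i (c i)) (m i) :=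
      fun c => IDCode.errorProb_le A β γ hA hβ hγ e he (IDCode.mk c (fun i => D i (c i))) m
    refine (Finset.sum_le_sum fun c _ => mul_le_mul_of_nonneg_left (h c) (hc c)).trans ?_
    simp_rw [Finset.mul_sum]
    rw [Finset.sum_comm]
    refine (Finset.sum_le_sum fun i _ => hD i m).trans ?_
    simp

end

end VBC

namespace VBC

open Filter Topology

variable {N n : ℕ}

/-! ### Enforcing the intensity constraints -/

/-- The number of ones in a sequence of bits. -/
def weight (u : Fin n → Bool) : ℝ := ∑ t, if u t then 1 else 0

open Classical in
/-- A codeword whose fraction of ones exceeds `q` is replaced by the zero sequence. -/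
noncomputable def trim (q : ℝ) (u : Fin n → Bool) : Fin n → Bool :=
  if weight u ≤ n * q then u else fun _ => false

theorem weight_nonneg (u : Fin n → Bool) : 0 ≤ weight u :=
  Finset.sum_nonneg fun _ _ => by split_ifs <;> norm_num

theorem weight_trim_le {q : ℝ} (hq : 0 ≤ q) (u : Fin n → Bool) : weight (trim q u) ≤ n * q := by
  unfold trim
  split_ifs with h
  · exact h
  · simpa [weight] using mul_nonneg n.cast_nonneg hq

theorem eq_false_of_weight_le_zero {u : Fin n → Bool} (h : weight u ≤ 0) (t : Fin n) :
    u t = false := by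
  have h0 : ∀ t ∈ Finset.univ, (0 : ℝ) ≤ if u t then 1 else 0 := fun t _ => by
    split_ifs <;> norm_num
  have := (Finset.sum_eq_zero_iff_of_nonneg h0).mp (le_antisymm h (weight_nonneg u)) t
    (Finset.mem_univ t)
  simpa using this

theorem value_le_of_support {A γ : ℝ} {p : Fin N → ℝ} (hp : ∀ i, 0 ≤ p i)
    (hA : ∑ i ∈ Finset.univ.filter (fun i => 0 < p i), (2 : ℝ) ^ (i : ℕ) ≤ γ * A)
    {x : Fin N → Bool} (hx : ∀ i, p i = 0 → x i = false) : value x ≤ γ * A := by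
  refine le_trans ?_ hA
  rw [Finset.sum_filter]
  refine Finset.sum_le_sum fun i _ => ?_
  rcases (hp i).eq_or_lt with h | h
  · simp [hx i h.symm, ← h]
  · rw [if_pos h]
    split_ifs
    · exact le_rfl
    · positivity

theorem sum_filter_pos_mul {p : Fin N → ℝ} (hp : ∀ i, 0 ≤ p i) (f : Fin N → ℝ) :
    ∑ i ∈ Finset.univ.filter (fun i => 0 < p i), p i * f i = ∑ i, p i * f i := by
  rw [Finset.sum_filter]
  refine Finset.sum_congr rfl fun i _ => ?_
  rcases (hp i).eq_or_lt with h | h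
  · simp [← h]
  · rw [if_pos h]

/-- Where `p i = 0` the weight bound forces zero codewords, so the peak constraint follows from that
on the active set; the time average is a weighted sum of codeword weights. -/
theorem feasible_of_weight_le {A E γ : ℝ} {p : Fin N → ℝ} (hp : p ∈ Admissible A E γ N)
    {M : Fin N → ℕ} (C : IDCode N n M) (hC : ∀ i j, weight (C.enc i j) ≤ n * p i) :
    C.Feasible A E γ := by
  obtain ⟨h01, hpeak, havg⟩ := hp
  intro m
  constructor
  · intro t
    refine value_le_of_support (fun i => (h01 i).1) hpeak fun i hi => ?_
    exact eq_false_of_weight_le_zero (by simpa [hi] using hC i (m i)) t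
  · rw [sum_filter_pos_mul fun i => (h01 i).1] at havg
    calc ∑ t, value (C.input m t) = ∑ i, weight (C.enc i (m i)) * 2 ^ (i : ℕ) := by
          simp only [value, weight, Finset.sum_mul]
          rw [Finset.sum_comm]
          exact Finset.sum_congr rfl fun i _ => Finset.sum_congr rfl fun t _ => by
            change (if C.enc i (m i) t then (2 : ℝ) ^ (i : ℕ) else 0) =
              (if C.enc i (m i) t then 1 else 0) * 2 ^ (i : ℕ)
            split_ifs <;> simp
      _ ≤ ∑ i, n * p i * 2 ^ (i : ℕ) :=
          Finset.sum_le_sum fun i _ => mul_le_mul_of_nonneg_right (hC i _) (by positivity)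
      _ = n * ∑ i, p i * 2 ^ (i : ℕ) := by
          rw [Finset.mul_sum]
          exact Finset.sum_congr rfl fun i _ => by ring
      _ ≤ _ := mul_le_mul_of_nonneg_left havg n.cast_nonneg

-- Chernoff bound using the slack `q i < p i`; on a switched-off bit-pipe the codewords vanish
-- almost surely.
open Classical in
theorem eventually_weight_le {p q : Fin N → ℝ} (hq : ∀ i, 0 ≤ q i ∧ q i ≤ 1) {i : Fin N}
    (hpq : (p i = 0 ∧ q i = 0) ∨ q i < p i) {ε : ℝ} (hε : 0 < ε) :
    ∀ᶠ n : ℕ in atTop, ∀ (M : Fin N → ℕ) (m : (i : Fin N) → Fin (M i)),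
      ∑ c : (i : Fin N) → Fin (M i) → Fin n → Bool, codebookProb q c *
        (if weight (c i (m i)) ≤ n * p i then 0 else 1) ≤ ε := by
  rcases hpq with ⟨hp0, hq0⟩ | hlt
  · refine Eventually.of_forall fun n M m => (le_of_eq ?_).trans hε.le
    refine Finset.sum_eq_zero fun c _ => ?_
    split_ifs with h
    · rw [mul_zero]
    · have : ∃ t, c i (m i) t = true := by
        by_contra! hall
        exact h (by simp [weight, hall, hp0])
      obtain ⟨t, ht⟩ := this
      have : codebookProb q c = 0 :=
        Finset.prod_eq_zero (Finset.mem_univ i) (Finset.prod_eq_zero (Finset.mem_univ (m i))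
          (Finset.prod_eq_zero (Finset.mem_univ t) (by rw [if_pos ht, hq0])))
      rw [this, zero_mul]
  · obtain ⟨l, hl, hlt1⟩ := exists_exp_moment_lt_one (S := Fin N → Bool)
      (fun x => ∏ i, bern (q i) (x i)) (fun x => (if x i then 1 else 0) - p i) (sum_prod_bern q)
      (by
        rw [sum_prod_bern_mul q i (fun b => (if b then 1 else 0) - p i)]
        simp [bern]
        linarith)
    have hρ0 : 0 ≤ ∑ x : Fin N → Bool, (∏ i, bern (q i) (x i)) *
        Real.exp (l * ((if x i then 1 else 0) - p i)) :=
      Finset.sum_nonneg fun x _ => mul_nonneg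
        (Finset.prod_nonneg fun i _ => bern_nonneg (hq i).1 (hq i).2 _) (Real.exp_pos _).le
    have hlim := tendsto_pow_atTop_nhds_zero_of_lt_one hρ0 hlt1
    filter_upwards [hlim.eventually (gt_mem_nhds hε)] with n hn M m
    refine le_trans ?_ hn.le
    rw [← sum_codebookProb_mul_prod q m
      (fun x => Real.exp (l * ((if x i then 1 else 0) - p i)))]
    refine Finset.sum_le_sum fun c _ =>
      mul_le_mul_of_nonneg_left ?_ (codebookProb_nonneg hq c)
    rw [← Real.exp_sum, ← Finset.mul_sum, Finset.sum_sub_distrib]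
    split_ifs with h
    · exact (Real.exp_pos _).le
    · refine Real.one_le_exp (mul_nonneg hl.le (sub_nonneg.mpr ?_))
      rw [Finset.sum_const, Finset.card_univ, Fintype.card_fin, nsmul_eq_mul]
      exact (not_le.mp h).le

/-! ### Deterministic codes -/

/-- The code with trimmed codewords. -/
noncomputable def trimCode {M : Fin N → ℕ} (p : Fin N → ℝ)
    (c : (i : Fin N) → Fin (M i) → Fin n → Bool)
    (D : (i : Fin N) → (Fin (M i) → Fin n → Bool) → (Fin n → Option Bool) → Fin (M i)) :
    IDCode N n M where
  enc i j := trim (p i) (c i j)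
  -- The decoders keep the untrimmed codebooks, so the random coding bound applies to them directly.
  dec i := D i (c i)

theorem exists_le_of_sum_mul_le {S : Type*} [Fintype S] {w F : S → ℝ} (hw0 : ∀ s, 0 ≤ w s)
    (hw : ∑ s, w s = 1) {K : ℝ} (h : ∑ s, w s * F s ≤ K) : ∃ s, F s ≤ K := by
  by_contra! hF
  obtain ⟨s, hs⟩ : ∃ s, 0 < w s := by
    by_contra! h0
    have := Finset.sum_nonpos fun s (_ : s ∈ Finset.univ) => h0 s
    linarith
  have : ∑ s, w s * K < ∑ s, w s * F s :=
    Finset.sum_lt_sum (fun s _ => mul_le_mul_of_nonneg_left (hF s).le (hw0 s))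
      ⟨s, Finset.mem_univ s, mul_lt_mul_of_pos_left (hF s) hs⟩
  rw [← Finset.sum_mul, hw, one_mul] at this
  linarith

/-- At least half of the messages have at most twice the average error. -/
theorem exists_embedding_half {K : ℕ} (f : Fin K → ℝ) (hf : ∀ j, 0 ≤ f j) {ε : ℝ} (hε : 0 < ε)
    (h : ∑ j, f j ≤ K * ε) : ∃ g : Fin ((K + 1) / 2) ↪ Fin K, ∀ j, f (g j) ≤ 2 * ε := by
  have hbad : ((Finset.univ.filter fun j => ¬ f j ≤ 2 * ε).card : ℝ) * (2 * ε) ≤ K * ε := by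
    refine le_trans ?_ h
    rw [← nsmul_eq_mul]
    refine (Finset.card_nsmul_le_sum _ f _ fun j hj => ?_).trans
      (Finset.sum_le_sum_of_subset_of_nonneg (Finset.filter_subset _ _) fun j _ _ => hf j)
    exact (not_le.mp (Finset.mem_filter.mp hj).2).le
  -- At most half are bad, rounded down, so `(K + 1) / 2`, half rounded up, remain; this is positive
  -- if `K` is.
  have hbad' : 2 * (Finset.univ.filter fun j => ¬ f j ≤ 2 * ε).card ≤ K := by
    have : (2 * (Finset.univ.filter fun j => ¬ f j ≤ 2 * ε).card : ℝ) ≤ K :=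
      le_of_mul_le_mul_right (by linarith) hε
    exact_mod_cast this
  have hcard := Finset.card_filter_add_card_filter_not (s := (Finset.univ : Finset (Fin K)))
    (fun j => f j ≤ 2 * ε)
  rw [Finset.card_univ, Fintype.card_fin] at hcard
  have hle : Fintype.card (Fin ((K + 1) / 2)) ≤
      Fintype.card {j // f j ≤ 2 * ε} := by
    rw [Fintype.card_subtype, Fintype.card_fin]; omega
  obtain ⟨g⟩ := Function.Embedding.nonempty_of_card_le hle
  exact ⟨g.trans (Function.Embedding.subtype _), fun j => (g j).2⟩

/-! ### Achievability under the intensity constraints -/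

section

variable {A β γ : ℝ} (hA : 0 < A) (hβ : 0 < β) (hγ : 0 < γ) {e : (Fin N → Bool) → ℝ}
  (he : ∀ x, 0 ≤ e x ∧ e x ≤ 1)

include hA hβ hγ he

/-- Trimming matters only if one of the `N` transmitted codewords is too heavy. That event is paid
for with the trivial bound one on the error. -/
theorem eventually_exists_decoders_trim {p q : Fin N → ℝ} (hq : ∀ i, 0 ≤ q i ∧ q i ≤ 1)
    (hpq : ∀ i, (p i = 0 ∧ q i = 0) ∨ q i < p i) {E : ℝ}
    (hE : ∀ x : Fin N → Bool, (∀ i, q i = 0 → x i = false) → e x ≤ E) {d ε : ℝ} (hd : 0 < d)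
    (hε : 0 < ε) :
    ∀ᶠ n : ℕ in atTop, ∀ M : Fin N → ℕ, (∀ i, M i = codeSize n (pipeRate A β γ q E d i)) →
      ∃ D : (i : Fin N) → (Fin (M i) → Fin n → Bool) → (Fin n → Option Bool) → Fin (M i),
        ∀ i (m : (i : Fin N) → Fin (M i)),
          ∑ c : (i : Fin N) → Fin (M i) → Fin n → Bool, codebookProb q c *
            pipeError (noiseLaw A β γ N) e ((trimCode p c D).input m) i (D i (c i)) (m i) ≤ ε := by
  classical
  have hN : (0 : ℝ) < N + 1 := by positivity
  have h1 := eventually_exists_decoders hA hβ hγ he hq hE hd (ε := ε / (N + 1)) (by positivity)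
  have h2 := eventually_all.mpr fun i => eventually_weight_le (p := p) hq (hpq i)
    (ε := ε / (N + 1)) (by positivity)
  filter_upwards [h1, h2] with n h1 h2 M hM
  obtain ⟨D, hD⟩ := h1 M hM
  refine ⟨D, fun i m => ?_⟩
  have h0 : ∀ (c : (i : Fin N) → Fin (M i) → Fin n → Bool) (i : Fin N),
      (0 : ℝ) ≤ if weight (c i (m i)) ≤ n * p i then 0 else 1 := by
    intro c i; split_ifs <;> norm_num
  have hle : ∀ c : (i : Fin N) → Fin (M i) → Fin n → Bool,
      pipeError (noiseLaw A β γ N) e ((trimCode p c D).input m) i (D i (c i)) (m i) ≤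
        pipeError (noiseLaw A β γ N) e (fun t i => c i (m i) t) i (D i (c i)) (m i) +
          ∑ i, if weight (c i (m i)) ≤ n * p i then 0 else 1 := by
    intro c
    by_cases hall : ∀ i, weight (c i (m i)) ≤ n * p i
    · have : (trimCode p c D).input m = fun t i => c i (m i) t := by
        funext t i
        simp [IDCode.input, trimCode, trim, hall i]
      rw [this]
      exact le_add_of_nonneg_right (Finset.sum_nonneg fun i _ => h0 c i)
    · push Not at hall
      obtain ⟨i', hi'⟩ := hall
      have h1 := pipeError_le_one (noiseLaw_nonneg hA hβ hγ) (sum_noiseLaw hA hβ hγ N) he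
        ((trimCode p c D).input m) i (D i (c i)) (m i)
      have h2 := pipeError_nonneg (noiseLaw_nonneg hA hβ hγ) he
        (fun t i => c i (m i) t) i (D i (c i)) (m i)
      have h3 := Finset.single_le_sum (fun i _ => h0 c i) (Finset.mem_univ i')
      rw [if_neg (not_le.mpr hi')] at h3
      linarith
  refine (Finset.sum_le_sum fun c _ =>
    mul_le_mul_of_nonneg_left (hle c) (codebookProb_nonneg hq c)).trans ?_
  simp only [mul_add, Finset.sum_add_distrib, Finset.mul_sum]
  have h3 : ∑ c : (i : Fin N) → Fin (M i) → Fin n → Bool, ∑ i, codebookProb q c *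
      (if weight (c i (m i)) ≤ n * p i then (0 : ℝ) else 1) ≤ N * (ε / (N + 1)) := by
    rw [Finset.sum_comm]
    refine (Finset.sum_le_sum fun i _ => h2 i M m).trans ?_
    simp
  refine (add_le_add (hD i m) h3).trans (le_of_eq ?_)
  field_simp
  ring

theorem achievableAvg_of_lt {E' : ℝ} {p q : Fin N → ℝ} (hp : p ∈ Admissible A E' γ N)
    (hq : ∀ i, 0 ≤ q i ∧ q i ≤ 1)
    (hpq : ∀ i, (p i = 0 ∧ q i = 0) ∨ q i < p i) {E : ℝ}
    (hE : ∀ x : Fin N → Bool, (∀ i, q i = 0 → x i = false) → e x ≤ E) :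
    AchievableAvg A E' β γ e ((1 - E) * sumRate A β γ q) := by
  intro δ hδ
  have h2 : 0 < Real.log 2 := Real.log_pos (by norm_num)
  have hN : (0 : ℝ) < N + 1 := by positivity
  have hev := eventually_exists_decoders_trim hA hβ hγ he hq hpq hE
    (d := δ * Real.log 2 / (N + 1)) (ε := δ / (N + 1)) (by positivity) (by positivity)
  obtain ⟨n₀, hn₀⟩ := eventually_atTop.mp (hev.and (eventually_gt_atTop 0))
  refine ⟨n₀, fun n hn => ?_⟩
  obtain ⟨hD, hn0⟩ := hn₀ n hn
  obtain ⟨M, hM⟩ : ∃ M : Fin N → ℕ,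
    ∀ i, M i = codeSize n (pipeRate A β γ q E (δ * Real.log 2 / (N + 1)) i) := ⟨_, fun _ => rfl⟩
  obtain ⟨D, hD⟩ := hD M hM
  have hM0 : ∀ i, 0 < M i := fun i => by rw [hM]; exact codeSize_pos _ _
  have hNδ : N * (δ / (N + 1)) ≤ δ := by
    rw [mul_div_assoc', div_le_iff₀ hN]; nlinarith
  refine ⟨M, hM0, ?_, ?_⟩
  · have := le_rate hn0 M (pipeRate A β γ q E (δ * Real.log 2 / (N + 1))) 0 fun i => by
      rw [hM, sub_zero]
      exact le_logb_codeSize _ _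
    rw [sum_pipeRate] at this
    refine le_trans ?_ this
    have : δ * Real.log 2 / (N + 1) / Real.log 2 = δ / (N + 1) := by field_simp
    rw [this]
    simp only [zero_div, mul_zero, sub_zero]
    linarith
  · have hprod : (0 : ℝ) < ∏ i, (M i : ℝ) := Finset.prod_pos fun i _ => by exact_mod_cast hM0 i
    have hsum : ∑ c : (i : Fin N) → Fin (M i) → Fin n → Bool, codebookProb q c *
        ∑ m : (i : Fin N) → Fin (M i), ∑ i, pipeError (noiseLaw A β γ N) e
          ((trimCode p c D).input m) i (D i (c i)) (m i) ≤
            (∏ i, (M i : ℝ)) * (N * (δ / (N + 1))) := by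
      simp_rw [Finset.mul_sum]
      rw [Finset.sum_comm]
      have : ∀ m ∈ (Finset.univ : Finset ((i : Fin N) → Fin (M i))),
          ∑ c : (i : Fin N) → Fin (M i) → Fin n → Bool, ∑ i, codebookProb q c *
            pipeError (noiseLaw A β γ N) e ((trimCode p c D).input m) i (D i (c i)) (m i) ≤
              N * (δ / (N + 1)) := by
        intro m _
        rw [Finset.sum_comm]
        refine (Finset.sum_le_sum fun i _ => hD i m).trans ?_
        simp
      refine (Finset.sum_le_card_nsmul _ _ _ this).trans (le_of_eq ?_)
      rw [Finset.card_univ, Fintype.card_pi, nsmul_eq_mul]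
      simp
    obtain ⟨c, hc⟩ := exists_le_of_sum_mul_le (codebookProb_nonneg hq)
      (sum_codebookProb q n M) hsum
    refine ⟨trimCode p c D, feasible_of_weight_le hp _ fun i j =>
      weight_trim_le (hp.1 i).1 _, ?_⟩
    unfold IDCode.avgErrorProb
    rw [div_le_iff₀ hprod]
    calc _ ≤ _ := Finset.sum_le_sum fun m _ => IDCode.errorProb_le A β γ hA hβ hγ e he _ m
      _ ≤ (∏ i, (M i : ℝ)) * (N * (δ / (N + 1))) := hc
      _ ≤ δ * ∏ i, (M i : ℝ) := by
        rw [mul_comm]; exact mul_le_mul_of_nonneg_right hNδ hprod.le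

theorem achievableMax_of_lt (hconst : ∀ x x', e x = e x') {E' : ℝ} {p q : Fin N → ℝ}
    (hp : p ∈ Admissible A E' γ N) (hq : ∀ i, 0 ≤ q i ∧ q i ≤ 1)
    (hpq : ∀ i, (p i = 0 ∧ q i = 0) ∨ q i < p i) {E : ℝ}
    (hE : ∀ x : Fin N → Bool, (∀ i, q i = 0 → x i = false) → e x ≤ E) :
    AchievableMax A E' β γ e ((1 - E) * sumRate A β γ q) := by
  intro δ hδ
  have h2 : 0 < Real.log 2 := Real.log_pos (by norm_num)
  have hN : (0 : ℝ) < N + 1 := by positivity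
  -- The selected codebook has total average error at most `(N + 1) * ε`; halving doubles this, and
  -- the union bound adds `N` such terms.
  obtain ⟨ε, hε, hεδ⟩ : ∃ ε > 0, N * (2 * ((N + 1) * ε)) ≤ δ := by
    refine ⟨δ / (2 * (N + 1) ^ 2), by positivity, ?_⟩
    have : (N : ℝ) * (2 * ((N + 1) * (δ / (2 * (N + 1) ^ 2)))) = N * δ / (N + 1) := by
      field_simp
    rw [this, div_le_iff₀ hN]
    nlinarith
  have hev := eventually_exists_decoders_trim hA hβ hγ he hq hpq hE
    (d := δ / 2 * Real.log 2 / (N + 1)) (ε := ε) (by positivity) hε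
  have hlim : Tendsto (fun n : ℕ => (N : ℝ) * (1 / (n : ℝ))) atTop (𝓝 0) := by
    simpa using tendsto_one_div_atTop_nhds_zero_nat.const_mul (N : ℝ)
  obtain ⟨n₀, hn₀⟩ := eventually_atTop.mp ((hev.and (eventually_gt_atTop 0)).and
    (hlim.eventually (gt_mem_nhds (half_pos hδ))))
  refine ⟨n₀, fun n hn => ?_⟩
  obtain ⟨⟨hD, hn0⟩, hnδ⟩ := hn₀ n hn
  obtain ⟨M, hM⟩ : ∃ M : Fin N → ℕ,
    ∀ i, M i = codeSize n (pipeRate A β γ q E (δ / 2 * Real.log 2 / (N + 1)) i) :=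
    ⟨_, fun _ => rfl⟩
  obtain ⟨D, hD⟩ := hD M hM
  have hM0 : ∀ i, 0 < M i := fun i => by rw [hM]; exact codeSize_pos _ _
  have hK0 : ∀ i, 0 < (M i + 1) / 2 := fun i => by have := hM0 i; omega
  -- Arbitrary reference messages for the other bit-pipes; with a constant erasure probability they
  -- do not affect the error of bit-pipe `i`.
  let m₀ : (i : Fin N) → Fin (M i) := fun i => ⟨0, hM0 i⟩
  have hpe0 : ∀ (c : (i : Fin N) → Fin (M i) → Fin n → Bool) i j,
      0 ≤ pipeError (noiseLaw A β γ N) e ((trimCode p c D).input (Function.update m₀ i j)) i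
        (D i (c i)) j := fun c i j => pipeError_nonneg (noiseLaw_nonneg hA hβ hγ) he _ _ _ _
  have hsum : ∑ c : (i : Fin N) → Fin (M i) → Fin n → Bool, codebookProb q c *
      ∑ i, (∑ j, pipeError (noiseLaw A β γ N) e
        ((trimCode p c D).input (Function.update m₀ i j)) i (D i (c i)) j) / M i ≤
          (N + 1) * ε := by
    simp_rw [Finset.mul_sum]
    rw [Finset.sum_comm]
    have : ∀ i ∈ (Finset.univ : Finset (Fin N)),
        ∑ c : (i : Fin N) → Fin (M i) → Fin n → Bool, codebookProb q c *
          ((∑ j, pipeError (noiseLaw A β γ N) e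
            ((trimCode p c D).input (Function.update m₀ i j)) i (D i (c i)) j) / M i) ≤ ε := by
      intro i _
      simp_rw [← mul_div_assoc, Finset.mul_sum]
      rw [← Finset.sum_div, Finset.sum_comm, div_le_iff₀ (by exact_mod_cast hM0 i)]
      have hj : ∀ j ∈ (Finset.univ : Finset (Fin (M i))),
          ∑ c : (i : Fin N) → Fin (M i) → Fin n → Bool, codebookProb q c *
            pipeError (noiseLaw A β γ N) e
              ((trimCode p c D).input (Function.update m₀ i j)) i (D i (c i)) j ≤ ε := by
        intro j _
        simpa using hD i (Function.update m₀ i j)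
      refine (Finset.sum_le_card_nsmul _ _ _ hj).trans (le_of_eq ?_)
      rw [Finset.card_univ, Fintype.card_fin, nsmul_eq_mul, mul_comm]
    refine (Finset.sum_le_card_nsmul _ _ _ this).trans ?_
    rw [Finset.card_univ, Fintype.card_fin, nsmul_eq_mul]
    linarith
  obtain ⟨c, hc⟩ := exists_le_of_sum_mul_le (codebookProb_nonneg hq)
    (sum_codebookProb q n M) hsum
  have hg : ∀ i, ∃ g : Fin ((M i + 1) / 2) ↪ Fin (M i), ∀ j,
      pipeError (noiseLaw A β γ N) e ((trimCode p c D).input (Function.update m₀ i (g j))) i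
        (D i (c i)) (g j) ≤ 2 * ((N + 1) * ε) := by
    intro i
    refine exists_embedding_half (fun j => pipeError (noiseLaw A β γ N) e
      ((trimCode p c D).input (Function.update m₀ i j)) i (D i (c i)) j) (hpe0 c i)
      (by positivity) ?_
    have hMi : (0 : ℝ) < M i := by exact_mod_cast hM0 i
    rw [mul_comm, ← div_le_iff₀ hMi]
    refine le_trans ?_ hc
    exact Finset.single_le_sum (f := fun i => (∑ j, pipeError (noiseLaw A β γ N) e
        ((trimCode p c D).input (Function.update m₀ i j)) i (D i (c i)) j) / M i)
      (fun i _ => div_nonneg (Finset.sum_nonneg fun j _ => hpe0 c i j) (Nat.cast_nonneg _))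
      (Finset.mem_univ i)
  choose g hg using hg
  have : ∀ i, Nonempty (Fin ((M i + 1) / 2)) := fun i => ⟨⟨0, hK0 i⟩⟩
  refine ⟨fun i => (M i + 1) / 2, hK0, ?_,
    -- `invFun` relabels decisions to the retained messages. A decision outside the range of `g i`
    -- was already an error, so its value does not matter.
    ⟨fun i j => trim (p i) (c i (g i j)), fun i y => Function.invFun (g i) (D i (c i) y)⟩,
    feasible_of_weight_le hp _ fun i j => weight_trim_le (hp.1 i).1 _, fun m => ?_⟩
  · have := le_rate hn0 (fun i => (M i + 1) / 2)
      (pipeRate A β γ q E (δ / 2 * Real.log 2 / (N + 1))) 1 fun i => by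
        have h1 : Real.logb 2 (M i) - 1 ≤ Real.logb 2 ((M i + 1) / 2 : ℕ) := by
          have hMi : (0 : ℝ) < M i := by exact_mod_cast hM0 i
          have h3 : Real.logb 2 (M i) - 1 = Real.logb 2 (M i / 2) := by
            rw [Real.logb_div hMi.ne' (by norm_num)]; simp
          rw [h3]
          refine Real.logb_le_logb_of_le (by norm_num) (by positivity) ?_
          have : M i ≤ 2 * ((M i + 1) / 2) := by omega
          have : (M i : ℝ) ≤ 2 * ((M i + 1) / 2 : ℕ) := by exact_mod_cast this
          linarith
        have h2 := le_logb_codeSize n (pipeRate A β γ q E (δ / 2 * Real.log 2 / (N + 1)) i)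
        rw [← hM i] at h2
        linarith
    rw [sum_pipeRate] at this
    refine le_trans ?_ this
    have h3 : δ / 2 * Real.log 2 / (N + 1) / Real.log 2 = δ / 2 / (N + 1) := by field_simp
    have h4 : N * (δ / 2 / (N + 1)) ≤ δ / 2 := by
      rw [mul_div_assoc', div_le_iff₀ hN]; nlinarith
    rw [h3]
    linarith
  · refine (IDCode.errorProb_le A β γ hA hβ hγ e he _ m).trans (le_trans ?_ hεδ)
    have : ∀ i ∈ (Finset.univ : Finset (Fin N)), pipeError (noiseLaw A β γ N) e
        (fun t i => trim (p i) (c i (g i (m i))) t) i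
        (fun y => Function.invFun (g i) (D i (c i) y)) (m i) ≤ 2 * ((N + 1) * ε) := by
      intro i _
      refine le_trans ?_ (hg i (m i))
      rw [pipeError_congr hconst (x' := fun t i => trim (p i) (c i (g i (m i))) t)
        (x := (trimCode p c D).input (Function.update m₀ i (g i (m i))))
        (fun t => by simp [IDCode.input, trimCode])]
      refine Finset.sum_le_sum fun s _ => mul_le_mul_of_nonneg_left ?_
        (Finset.prod_nonneg fun _ _ => stateProb_nonneg (noiseLaw_nonneg hA hβ hγ) he _ _)
      split_ifs with h1 h3 h3
      · exact le_rfl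
      · exact zero_le_one
      · exact absurd (by simp only [h3]; exact Function.leftInverse_invFun (g i).injective _) h1
      · exact le_rfl
    refine (Finset.sum_le_card_nsmul _ _ _ this).trans (le_of_eq ?_)
    rw [Finset.card_univ, Fintype.card_fin, nsmul_eq_mul]

end

/-! ### The optimal parameters -/

theorem continuous_sumRate (A β γ : ℝ) : Continuous (sumRate A β γ (N := N)) := by
  unfold sumRate binEnt bconv
  fun_prop

/-- The set of active bit-pipes is not continuous in `p`, but it may be replaced by any larger `s`
meeting the peak constraint. This gives a finite union of closed subsets of the cube. -/
theorem isCompact_admissible (A E γ : ℝ) (N : ℕ) : IsCompact (Admissible A E γ N) := by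
  have h : Admissible A E γ N = ⋃ s ∈ {s : Finset (Fin N) | ∑ i ∈ s, (2 : ℝ) ^ (i : ℕ) ≤ γ * A},
      (Set.Icc 0 1 ∩ {p : Fin N → ℝ | (∀ i, i ∉ s → p i = 0) ∧
        ∑ i, p i * (2 : ℝ) ^ (i : ℕ) ≤ γ * E}) := by
    ext p
    simp only [Set.mem_iUnion, Set.mem_ofPred_eq, exists_prop, Set.mem_inter_iff, Set.mem_Icc,
      Pi.le_def, Pi.zero_apply, Pi.one_apply, Admissible]
    constructor
    · rintro ⟨h01, hA, hE⟩
      refine ⟨_, hA, ⟨fun i => (h01 i).1, fun i => (h01 i).2⟩, fun i hi => ?_, ?_⟩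
      · have : ¬ 0 < p i := by simpa using hi
        exact le_antisymm (not_lt.mp this) (h01 i).1
      · rwa [sum_filter_pos_mul fun i => (h01 i).1] at hE
    · rintro ⟨s, hA, ⟨h0, h1⟩, hs, hE⟩
      refine ⟨fun i => ⟨h0 i, h1 i⟩, le_trans ?_ hA, by rwa [sum_filter_pos_mul h0]⟩
      refine Finset.sum_le_sum_of_subset_of_nonneg (fun i hi => ?_) fun i _ _ => by positivity
      by_contra his
      exact (Finset.mem_filter.mp hi).2.ne' (hs i his)
  rw [h]
  refine (Set.toFinite _).isCompact_biUnion fun s _ => isCompact_Icc.inter_right ?_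
  rw [Set.ofPred_and]
  refine IsClosed.inter ?_ (isClosed_le (by fun_prop) continuous_const)
  simp only [Set.ofPred_forall]
  exact isClosed_iInter fun i => isClosed_iInter fun _ => isClosed_eq (by fun_prop) (by fun_prop)

theorem zero_mem_admissible {A E γ : ℝ} (hA : 0 < A) (hE : 0 < E) (hγ : 0 < γ) :
    (0 : Fin N → ℝ) ∈ Admissible A E γ N := by
  refine ⟨fun i => ⟨le_rfl, zero_le_one⟩, ?_, ?_⟩ <;> simp <;> positivity

/-- The parameters can be decreased at an arbitrarily small loss of rate. -/
theorem exists_smaller_parameters (A β γ : ℝ) {p : Fin N → ℝ} (hp : ∀ i, 0 ≤ p i ∧ p i ≤ 1)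
    (E : ℝ) {δ : ℝ} (hδ : 0 < δ) :
    ∃ q : Fin N → ℝ, (∀ i, 0 ≤ q i ∧ q i ≤ 1) ∧
      (∀ i, (p i = 0 ∧ q i = 0) ∨ q i < p i) ∧
      (1 - E) * sumRate A β γ p - δ < (1 - E) * sumRate A β γ q := by
  -- Scaling by `1 - η` keeps the zeros of `p` and strictly lowers its positive entries.
  have hcont : Continuous fun η : ℝ => (1 - E) * sumRate A β γ ((1 - η) • p) :=
    continuous_const.mul ((continuous_sumRate A β γ).comp (by fun_prop))
  have hev := (hcont.tendsto 0).eventually (lt_mem_nhds (b := _)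
    (show (1 - E) * sumRate A β γ p - δ < (1 - E) * sumRate A β γ ((1 - (0 : ℝ)) • p) by
      rw [sub_zero, one_smul]; linarith))
  obtain ⟨η, hη, hη0, hη1⟩ := ((hev.filter_mono nhdsWithin_le_nhds).and
    (Ioo_mem_nhdsGT (zero_lt_one' ℝ))).exists
  have h1 : 0 < 1 - η := sub_pos.mpr hη1
  refine ⟨(1 - η) • p, fun i => ⟨mul_nonneg h1.le (hp i).1, ?_⟩, fun i => ?_, hη⟩
  · simp only [Pi.smul_apply, smul_eq_mul]
    nlinarith [(hp i).1, (hp i).2]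
  · rcases (hp i).1.eq_or_lt with h | h
    · left; simp [← h]
    · right
      simp only [Pi.smul_apply, smul_eq_mul]
      nlinarith

end VBC

theorem theorem2 (A E β γ : ℝ) (hA : 0 < A) (hE : 0 < E) (hβ : 0 < β) (hγ : 0 < γ)
    (N : ℕ) (hN : N = VBC.numBits A β γ)
    (e : (Fin N → Bool) → ℝ) (he : ∀ x, 0 ≤ e x ∧ e x ≤ 1)
    (he' : ∀ x, VBC.value x ≤ γ * A → e x ≤ VBC.erasureBound β) :
    ∃ S : ℝ, IsGreatest (VBC.sumRate A β γ '' VBC.Admissible A E γ N) S ∧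
      (∀ p ∈ VBC.Admissible A E γ N,
        VBC.EnsembleAchieves A β γ e p ((1 - VBC.erasureBound β) * VBC.sumRate A β γ p)) ∧
      VBC.AchievableAvg A E β γ e ((1 - VBC.erasureBound β) * S) ∧
      ((∀ x x', e x = e x') →
        VBC.AchievableMax A E β γ e ((1 - VBC.erasureBound β) * S)) := by
  have hE' : ∀ p ∈ VBC.Admissible A E γ N, ∀ x : Fin N → Bool,
      (∀ i, p i = 0 → x i = false) → e x ≤ VBC.erasureBound β := fun p hp x hx =>
    he' x (VBC.value_le_of_support (fun i => (hp.1 i).1) hp.2.1 hx)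
  obtain ⟨S, hS⟩ := ((VBC.isCompact_admissible A E γ N).image
    (VBC.continuous_sumRate A β γ)).exists_isGreatest
    (Set.Nonempty.image _ ⟨0, VBC.zero_mem_admissible hA hE hγ⟩)
  obtain ⟨p, hp, rfl⟩ := hS.1
  refine ⟨_, hS, fun p hp => VBC.ensembleAchieves hA hβ hγ he hp.1 (hE' p hp), ?_, ?_⟩
  · intro δ hδ
    obtain ⟨q, hq, hpq, hrate⟩ :=
      VBC.exists_smaller_parameters A β γ hp.1 (VBC.erasureBound β) (half_pos hδ)
    -- Half of `δ` is lost in passing to `q`, half in the code. Since `q` vanishes where `p` does,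
    -- the erasure bound carries over.
    obtain ⟨n₀, hn₀⟩ := VBC.achievableAvg_of_lt hA hβ hγ he hp hq hpq
      (fun x hx => hE' p hp x fun i hi => hx i ((hpq i).elim (fun h => h.2)
        fun h => absurd (hq i).1 (by linarith))) (δ / 2) (half_pos hδ)
    refine ⟨n₀, fun n hn => ?_⟩
    obtain ⟨M, hM0, hr, C, hC, herr⟩ := hn₀ n hn
    exact ⟨M, hM0, by linarith, C, hC, by linarith⟩
  · intro hconst δ hδ
    obtain ⟨q, hq, hpq, hrate⟩ :=
      VBC.exists_smaller_parameters A β γ hp.1 (VBC.erasureBound β) (half_pos hδ)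
    obtain ⟨n₀, hn₀⟩ := VBC.achievableMax_of_lt hA hβ hγ he hconst hp hq hpq
      (fun x hx => hE' p hp x fun i hi => hx i ((hpq i).elim (fun h => h.2)
        fun h => absurd (hq i).1 (by linarith))) (δ / 2) (half_pos hδ)
    refine ⟨n₀, fun n hn => ?_⟩
    obtain ⟨M, hM0, hr, C, hC, herr⟩ := hn₀ n hn
    exact ⟨M, hM0, by linarith, C, hC, fun m => (herr m).trans (by linarith)⟩
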